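/- Let $d\ge 1$ and $U=\{e\in\mathbb Z^d: |e|=1\}$, where $|x|=|x_1|+\dots+|x_d|$. Let $(\Omega,\mathcal F,\mathbb P)$ be a probability space with commuting $\mathbb P$-preserving transformations $T_e:\Omega\to\Omega$, $e\in U$, such that $T_e$ and $T_{-e}$ are inverse to each other, and assume that the family is ergodic: every measurable set invariant under all the $T_e$, $e\in U$, has measure $0$ or $1$. For $x\in\mathbb Z^d$ let $T_x=T_{e_1}^{x_1}\cdots T_{e_d}^{x_d}$. Let $F:\Omega\times U\to\mathbb R$ be in the class $\mathcal K$, that is: (i) for each $e\in U$ there is $\alpha>0$ with $F(\cdot,e)\in L^{d+\alpha}(\mathbb P)$; (ii) $\mathbb E[F(\cdot,e)]=0$ for each $e\in U$; (iii) for a.e. $\omega$, $\sum_{i=0}^{m-1}F(T_{x_i}\omega,x_{i+1}-x_i)=0$ for every closed nearest-neighbour path $x_0,x_1,\dots,x_m=x_0$ in $\mathbb Z^d$ (all $x_{i+1}-x_i\in U$). Then for $\mathbb P$-a.e. $\omega$ the following holds. For all $x,y\in\mathbb Z^d$ the sum $\sum_{i=0}^{m-1}F(T_{z_i}\omega,z_{i+1}-z_i)$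 along a nearest-neighbour path $z_0=x,\dots,z_m=y$ does not depend on the path; and if $f(z)=f(z,\omega)$ denotes the sum along any path from $0$ to $z$, then $$\lim_{n\to\infty}\ \sup_{z\in\mathbb Z^d,\ |z|\le n}\frac{f(z)}{n}=0\qquad\text{and}\qquad \lim_{n\to\infty}\ \sup_{z\in\mathbb Z^d,\ |z|\le n}\frac{|f(z)|}{n}=0 .$$ -/

import Mathlib

open MeasureTheory Filter Topology

/-- The `ℓ¹` norm of a point of the lattice `ℤ^d`. -/
def l1norm {d : ℕ} (x : Fin d → ℤ) : ℕ := ∑ i, (x i).natAbs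

/-- The set `U` of nearest-neighbour steps, `{e ∈ ℤ^d : |e| = 1}`. -/
abbrev UnitStep (d : ℕ) : Type := {e : Fin d → ℤ // l1norm e = 1}

/-- The coordinate vector `e_i`, as an element of `U`. -/
def UnitStep.pos {d : ℕ} (i : Fin d) : UnitStep d :=
  ⟨Pi.single i 1, by
    unfold l1norm
    rw [Finset.sum_eq_single i] <;> simp +contextual [Pi.single_apply]⟩

/-- The opposite step `-e`. -/
def UnitStep.neg {d : ℕ} (e : UnitStep d) : UnitStep d :=
  ⟨-e.1, by simpa [l1norm] using e.2⟩

/-- `(T_e)_{e ∈ U}` is an ergodic family of commuting `P`-preserving transformations, in which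
`T_e` and `T_{-e}` are inverse to each other. Ergodicity is that of the whole family: a
measurable set which is invariant under every `T_e` has measure zero or one. -/
structure IsErgodicFamily {d : ℕ} {Ω : Type*} [MeasurableSpace Ω]
    (T : UnitStep d → Ω → Ω) (P : Measure Ω) : Prop where
  measurePreserving : ∀ e, MeasurePreserving (T e) P P
  comm : ∀ e e' ω, T e (T e' ω) = T e' (T e ω)
  inverse : ∀ e ω, T e.neg (T e ω) = ω
  ergodic : ∀ A : Set Ω, MeasurableSet A → (∀ e, T e ⁻¹' A = A) → P A = 0 ∨ P A = 1

/-- The transformation `T_x`, `x ∈ ℤ^d`: the composition over `i` of `|x_i|` copies of `T_{e_i}`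
(if `x_i ≥ 0`) or of `T_{-e_i}` (if `x_i < 0`). -/
def shift {d : ℕ} {Ω : Type*} (T : UnitStep d → Ω → Ω) (x : Fin d → ℤ) : Ω → Ω :=
  (List.ofFn fun i : Fin d =>
    (T (UnitStep.pos i))^[(x i).toNat] ∘ (T (UnitStep.pos i).neg)^[(-(x i)).toNat]).foldr
      (fun g h => g ∘ h) id

/-- Nearest-neighbour paths in `ℤ^d` from `x` to `y`: finite sequences of lattice points from `x`
to `y` with increments in `U`. -/
inductive LatticePath {d : ℕ} : (Fin d → ℤ) → (Fin d → ℤ) → Type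
  | nil (x : Fin d → ℤ) : LatticePath x x
  | cons {x y : Fin d → ℤ} (e : UnitStep d) (γ : LatticePath (x + e.1) y) : LatticePath x y

/-- The sum of `F` along a path `x_0, …, x_m` in the environment `ω`, that is
`∑_{i < m} F(x_i, x_{i+1})`, where `F(x, x + e) = F(T_x ω, e)`. -/
def LatticePath.sum {d : ℕ} {Ω : Type*} (T : UnitStep d → Ω → Ω) (F : Ω → UnitStep d → ℝ)
    (ω : Ω) : {x y : Fin d → ℤ} → LatticePath x y → ℝ
  | _, _, .nil _ => 0
  | x, _, .cons e γ => F (shift T x ω) e + γ.sum T F ω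

/-- The class `𝒦`: moment condition, mean zero, and the closed loop condition (which is required
for almost every environment). -/
structure ClassK {d : ℕ} {Ω : Type*} [MeasurableSpace Ω] (T : UnitStep d → Ω → Ω)
    (P : Measure Ω) (F : Ω → UnitStep d → ℝ) : Prop where
  moment : ∀ e, ∃ α : ℝ, 0 < α ∧ MemLp (fun ω => F ω e) (ENNReal.ofReal (d + α)) P
  mean_zero : ∀ e, ∫ ω, F ω e ∂P = 0
  closed_loop : ∀ᵐ ω ∂P, ∀ (x : Fin d → ℤ) (γ : LatticePath x x), γ.sum T F ω = 0

/-- Concatenation of paths. -/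
def LatticePath.append {d : ℕ} : {x y z : Fin d → ℤ} →
    LatticePath x y → LatticePath y z → LatticePath x z
  | _, _, _, .nil _, δ => δ
  | _, _, _, .cons e γ, δ => .cons e (γ.append δ)

/-- Any two points of `ℤ^d` are joined by a path. -/
theorem LatticePath.nonempty {d : ℕ} (x y : Fin d → ℤ) : Nonempty (LatticePath x y) := by
  let S : AddSubmonoid (Fin d → ℤ) :=
    { carrier := {z | ∀ x, Nonempty (LatticePath x (x + z))}
      zero_mem' := fun x => by rw [add_zero]; exact ⟨.nil x⟩
      add_mem' := fun {a b} ha hb x => by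
        obtain ⟨γ⟩ := ha x
        obtain ⟨δ⟩ := hb (x + a)
        rw [← add_assoc]
        exact ⟨γ.append δ⟩ }
  have hU : ∀ e : UnitStep d, e.1 ∈ S := fun e x => ⟨.cons e (.nil _)⟩
  have hS : ∀ z : Fin d → ℤ, z ∈ S := by
    intro z
    rw [← Finset.univ_sum_single z]
    refine S.sum_mem fun i _ => ?_
    obtain ⟨n, hn | hn⟩ := (z i).eq_nat_or_neg
    · have h : Pi.single i (z i) = n • (UnitStep.pos i).1 := by
        rw [hn]; ext j; simp [UnitStep.pos, Pi.single_apply]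
      rw [h]
      exact S.nsmul_mem (hU _) n
    · have h : Pi.single i (z i) = n • (UnitStep.pos i).neg.1 := by
        rw [hn]; ext j; by_cases hj : j = i <;>
          simp [UnitStep.pos, UnitStep.neg, Pi.single_apply, hj]
      rw [h]
      exact S.nsmul_mem (hU _) n
  simpa using hS (y - x) x

/-- The sum of `F` from `x` to `y`: its sum along some path from `x` to `y`. -/
noncomputable def sumBetween {d : ℕ} {Ω : Type*} (T : UnitStep d → Ω → Ω)
    (F : Ω → UnitStep d → ℝ) (ω : Ω) (x y : Fin d → ℤ) : ℝ :=
  (Classical.choice (LatticePath.nonempty x y)).sum T F ω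

/-- `f(x)`, the sum of `F` from `0` to `x`. -/
noncomputable def pathPotential {d : ℕ} {Ω : Type*} (T : UnitStep d → Ω → Ω)
    (F : Ω → UnitStep d → ℝ) (ω : Ω) (x : Fin d → ℤ) : ℝ :=
  sumBetween T F ω 0 x

/-! The loop condition makes `f` a lattice function with stationary gradient, f(z+e) - f(z) = F(T_z
ω, e), and this gradient has p-th moments for some p > d. This is the range of Morrey's inequality,
so large-scale bounds on the gradient control `f` uniformly.

A Vitali covering argument applied along orbits gives a weak (1,1) inequality for means over dyadic
cubes. Hence almost surely the p-energy of `f` on the cube of radius 2^k is at most M 2^(kd) for all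
k (`ae_exists_gradientEnergy_le`). The discrete Morrey inequality
(`exists_abs_add_sub_le_gradientEnergy`) then bounds the oscillation of `f` over a subcube of side
2^m in the cube of radius 2^(m+j) by a constant times 2^(m+j) 2^(-j(1-d/p)). For j large and fixed
this is a small fraction of 2^(m+j). What remains are the grid points 2^m v with v in a finite set,
that is, finitely many rays.

On a ray, f(kv) is a Birkhoff sum for T_v of an integrable function of mean zero. T_v alone need not
be ergodic. However, the energy bound makes a single increment of `f` near kv of order k^(d/p) =
o(k), so the upper limit of f(kv)/k does not change when ω is replaced by T_e ω. Ergodicity of the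
whole family then makes it constant, and the maximal ergodic theorem shows that it is not positive
(`ae_eventually_birkhoffSum_le`). The same holds for -f. -/

/-! ### The action of the lattice on the probability space. -/

section ShiftAlgebra

variable {d : ℕ} {Ω : Type*} [MeasurableSpace Ω] {T : UnitStep d → Ω → Ω} {P : Measure Ω}

theorem UnitStep.neg_neg (e : UnitStep d) : e.neg.neg = e := by
  ext; simp [UnitStep.neg]

theorem UnitStep.eq_pos_or_neg (e : UnitStep d) :
    ∃ i, e = UnitStep.pos i ∨ e = (UnitStep.pos i).neg := by
  obtain ⟨x, hx⟩ := e
  have hne : ∃ i, x i ≠ 0 := by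
    by_contra! h
    simp [l1norm, h] at hx
  obtain ⟨i, hi⟩ := hne
  have h1 := Finset.add_sum_erase Finset.univ (fun j => (x j).natAbs) (Finset.mem_univ i)
  have h2 : ∑ j, (x j).natAbs = 1 := hx
  have h3 : 0 < (x i).natAbs := Int.natAbs_pos.2 hi
  have h4 : ∑ j ∈ Finset.univ.erase i, (x j).natAbs = 0 := by omega
  have h5 : ∀ j, j ≠ i → x j = 0 := fun j hj => by
    have := Finset.sum_eq_zero_iff.1 h4 j (by simp [hj])
    simpa using this
  have h6 : (x i).natAbs = 1 := by omega
  refine ⟨i, ?_⟩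
  rcases Int.natAbs_eq (x i) with h | h <;> rw [h6] at h
  · left
    ext j
    by_cases hj : j = i
    · subst hj; simp [UnitStep.pos, h]
    · simp [UnitStep.pos, h5 j hj, hj]
  · right
    ext j
    by_cases hj : j = i
    · subst hj; simp [UnitStep.pos, UnitStep.neg, h]
    · simp [UnitStep.pos, UnitStep.neg, h5 j hj, hj]

/-- The transformation `T_e` as a permutation of `Ω`. -/
def IsErgodicFamily.perm (hT : IsErgodicFamily T P) (e : UnitStep d) : Equiv.Perm Ω where
  toFun := T e
  invFun := T e.neg
  left_inv := hT.inverse e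
  right_inv ω := by simpa [e.neg_neg] using hT.inverse e.neg ω

theorem IsErgodicFamily.commute_perm (hT : IsErgodicFamily T P) (e e' : UnitStep d) :
    Commute (hT.perm e) (hT.perm e') :=
  Equiv.ext fun ω => hT.comm e e' ω

theorem Equiv.Perm.coe_iterate_comp_iterate_inv {α : Type*} (p : Equiv.Perm α) (n : ℤ) :
    (⇑p)^[n.toNat] ∘ (⇑p⁻¹)^[(-n).toNat] = ⇑(p ^ n) := by
  rw [← Equiv.Perm.coe_pow, ← Equiv.Perm.coe_pow, ← Equiv.Perm.coe_mul]
  congr 1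
  rcases n.eq_nat_or_neg with ⟨k, rfl | rfl⟩ <;> simp

theorem Equiv.Perm.foldr_comp {α : Type*} (l : List (Equiv.Perm α)) :
    (l.map fun p : Equiv.Perm α => (⇑p : α → α)).foldr (fun g h => g ∘ h) id = ⇑l.prod := by
  induction l with
  | nil => rfl
  | cons p l ih => simp [ih]

/-- Passing to the group of permutations turns the additivity of the shift into algebra with integer
powers of commuting elements. -/
theorem IsErgodicFamily.shift_eq_prod (hT : IsErgodicFamily T P) (x : Fin d → ℤ) :
    shift T x = ⇑(List.ofFn fun i => hT.perm (UnitStep.pos i) ^ x i).prod := by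
  rw [← Equiv.Perm.foldr_comp, List.map_ofFn]
  unfold shift
  congr 2
  funext i
  exact Equiv.Perm.coe_iterate_comp_iterate_inv (hT.perm (UnitStep.pos i)) (x i)

theorem List.prod_ofFn_zpow_add {G : Type*} [Group G] : ∀ {n : ℕ} (p : Fin n → G)
    (_ : ∀ i j, Commute (p i) (p j)) (x y : Fin n → ℤ),
    (List.ofFn fun i => p i ^ (x i + y i)).prod =
      (List.ofFn fun i => p i ^ x i).prod * (List.ofFn fun i => p i ^ y i).prod
  | 0, _, _, _, _ => by simp
  | n + 1, p, hp, x, y => by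
    have ih := List.prod_ofFn_zpow_add (fun i : Fin n => p i.succ) (fun i j => hp _ _)
      (fun i => x i.succ) (fun i => y i.succ)
    have hc : Commute (p 0 ^ y 0) (List.ofFn fun i : Fin n => p i.succ ^ x i.succ).prod := by
      refine Commute.list_prod_right _ _ fun g hg => ?_
      obtain ⟨i, rfl⟩ := (List.mem_ofFn' _ _).1 hg
      exact ((hp _ _).zpow_left _).zpow_right _
    simp only [List.ofFn_succ, List.prod_cons, ih]
    rw [zpow_add, mul_assoc, mul_assoc, ← mul_assoc (p 0 ^ y 0), hc.eq, mul_assoc]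

theorem List.prod_ofFn_zpow_single {G : Type*} [Group G] : ∀ {n : ℕ} (p : Fin n → G) (i : Fin n),
    (List.ofFn fun j => p j ^ (Pi.single i (1 : ℤ) : Fin n → ℤ) j).prod = p i
  | 0, _, i => i.elim0
  | n + 1, p, i => by
    rw [List.ofFn_succ, List.prod_cons]
    refine Fin.cases ?_ (fun i => ?_) i
    · simp
    · have ih := List.prod_ofFn_zpow_single (fun j : Fin n => p j.succ) i
      simp only [Pi.single_apply, Fin.succ_inj] at ih ⊢
      rw [ih]
      simp [(Fin.succ_ne_zero i).symm]

theorem IsErgodicFamily.shift_zero (hT : IsErgodicFamily T P) (ω : Ω) : shift T 0 ω = ω := by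
  simp [hT.shift_eq_prod]

theorem IsErgodicFamily.shift_add (hT : IsErgodicFamily T P) (x y : Fin d → ℤ) (ω : Ω) :
    shift T (x + y) ω = shift T x (shift T y ω) := by
  have := List.prod_ofFn_zpow_add (fun i => hT.perm (UnitStep.pos i))
    (fun i j => hT.commute_perm _ _) x y
  simp only [hT.shift_eq_prod, Pi.add_apply, this, Equiv.Perm.mul_apply]

theorem IsErgodicFamily.shift_unitStep (hT : IsErgodicFamily T P) (e : UnitStep d) (ω : Ω) :
    shift T e.1 ω = T e ω := by
  have hpos : ∀ i, ∀ ω, shift T (UnitStep.pos i).1 ω = T (UnitStep.pos i) ω := fun i ω => by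
    have := List.prod_ofFn_zpow_single (fun i => hT.perm (UnitStep.pos i)) i
    simp only [hT.shift_eq_prod, UnitStep.pos] at this ⊢
    rw [this]
    rfl
  obtain ⟨i, rfl | rfl⟩ := e.eq_pos_or_neg
  · exact hpos i ω
  · have h := hpos i (shift T (UnitStep.pos i).neg.1 ω)
    rw [← hT.shift_add] at h
    have h0 : (UnitStep.pos i).1 + (UnitStep.pos i).neg.1 = 0 := by simp [UnitStep.neg]
    rw [h0, hT.shift_zero] at h
    conv_rhs => rw [h]
    exact (hT.inverse _ _).symm

theorem LatticePath.induction_on_endpoint {x : Fin d → ℤ} {p : (Fin d → ℤ) → Prop} (h0 : p x)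
    (hs : ∀ y (e : UnitStep d), p y → p (y + e.1)) (y : Fin d → ℤ) : p y := by
  have key : ∀ {x y : Fin d → ℤ}, LatticePath x y → p x → p y := by
    intro x y γ
    induction γ with
    | nil _ => exact id
    | cons e γ ih => exact fun h => ih (hs _ e h)
  exact key (LatticePath.nonempty x y).some h0

theorem IsErgodicFamily.measurePreserving_shift (hT : IsErgodicFamily T P) (x : Fin d → ℤ) :
    MeasurePreserving (shift T x) P P := by
  refine LatticePath.induction_on_endpoint (x := 0)
    (p := fun x => MeasurePreserving (shift T x) P P) ?_ (fun y e h => ?_) x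
  · rw [show shift T 0 = id from funext hT.shift_zero]
    exact MeasurePreserving.id P
  · have : shift T (y + e.1) = shift T y ∘ T e := funext fun ω => by
      rw [hT.shift_add, hT.shift_unitStep, Function.comp_apply]
    rw [this]
    exact h.comp (hT.measurePreserving e)

theorem IsErgodicFamily.iterate_shift (hT : IsErgodicFamily T P) (v : Fin d → ℤ) (k : ℕ) (ω : Ω) :
    (shift T v)^[k] ω = shift T (k • v) ω := by
  induction k with
  | zero => simp [hT.shift_zero]
  | succ k ih => rw [Function.iterate_succ_apply', ih, ← hT.shift_add, succ_nsmul']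

/-- A measurable set which is almost everywhere carried into itself by every `T_e` has measure
zero or one. -/
theorem IsErgodicFamily.measure_eq_zero_or_one (hT : IsErgodicFamily T P) [IsProbabilityMeasure P]
    {A : Set Ω} (hA : MeasurableSet A) (h : ∀ e, ∀ᵐ ω ∂P, ω ∈ A → T e ω ∈ A) :
    P A = 0 ∨ P A = 1 := by
  have hx : ∀ x, ∀ᵐ ω ∂P, ω ∈ A → shift T x ω ∈ A := fun x => by
    refine LatticePath.induction_on_endpoint (x := 0)
      (p := fun x => ∀ᵐ ω ∂P, ω ∈ A → shift T x ω ∈ A) ?_ (fun y e hy => ?_) x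
    · exact ae_of_all _ fun ω => by simp [hT.shift_zero]
    · filter_upwards [hy, (hT.measurePreserving_shift y).quasiMeasurePreserving.ae (h e)]
        with ω h1 h2 hω
      rw [add_comm, hT.shift_add, hT.shift_unitStep]
      exact h2 (h1 hω)
  -- The ergodicity hypothesis needs exact invariance. Requiring the whole orbit to stay in A gives
  -- an exactly invariant set, which differs from A by a null set because the lattice is countable.
  set B : Set Ω := {ω | ∀ x, shift T x ω ∈ A} with hB
  have hBm : MeasurableSet B := by
    rw [hB, Set.ofPred_forall]
    exact MeasurableSet.iInter fun x => (hT.measurePreserving_shift x).measurable hA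
  have hAB : P A = P B := by
    refine measure_congr ?_
    filter_upwards [ae_all_iff.2 hx] with ω hω
    refine propext ⟨fun hA x => hω x hA, fun hB => ?_⟩
    have := hB 0
    rwa [hT.shift_zero] at this
  rw [hAB]
  refine hT.ergodic B hBm fun e => ?_
  ext ω
  constructor
  · intro hω x
    have := hω (x - e.1)
    rwa [← hT.shift_unitStep, ← hT.shift_add, sub_add_cancel] at this
  · intro hω x
    rw [← hT.shift_unitStep, ← hT.shift_add]
    exact hω _

end ShiftAlgebra

/-! ### Path sums and the potential. -/

section PathSums

variable {d : ℕ} {Ω : Type*} {T : UnitStep d → Ω → Ω} {F : Ω → UnitStep d → ℝ} {ω : Ω}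

theorem LatticePath.sum_append {x y z : Fin d → ℤ} (γ : LatticePath x y) (δ : LatticePath y z) :
    (γ.append δ).sum T F ω = γ.sum T F ω + δ.sum T F ω := by
  induction γ with
  | nil _ => simp [LatticePath.append, LatticePath.sum]
  | cons e γ ih => simp [LatticePath.append, LatticePath.sum, ih, add_assoc]

theorem LatticePath.sum_eq_of_closed_loop
    (hω : ∀ (x : Fin d → ℤ) (γ : LatticePath x x), γ.sum T F ω = 0) {x y : Fin d → ℤ}
    (γ δ : LatticePath x y) : γ.sum T F ω = δ.sum T F ω := by
  obtain ⟨ε⟩ := LatticePath.nonempty y x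
  have h1 := hω x (γ.append ε)
  have h2 := hω x (δ.append ε)
  rw [LatticePath.sum_append] at h1 h2
  linarith

theorem pathPotential_zero (hω : ∀ (x : Fin d → ℤ) (γ : LatticePath x x), γ.sum T F ω = 0) :
    pathPotential T F ω 0 = 0 := hω _ _

theorem pathPotential_add_step (hω : ∀ (x : Fin d → ℤ) (γ : LatticePath x x), γ.sum T F ω = 0)
    (z : Fin d → ℤ) (e : UnitStep d) :
    pathPotential T F ω (z + e.1) = pathPotential T F ω z + F (shift T z ω) e := by
  have h := LatticePath.sum_eq_of_closed_loop hω
    (Classical.choice (LatticePath.nonempty 0 (z + e.1)))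
    ((Classical.choice (LatticePath.nonempty 0 z)).append (.cons e (.nil _)))
  rw [LatticePath.sum_append] at h
  simpa [LatticePath.sum, pathPotential, sumBetween] using h

variable [MeasurableSpace Ω] {P : Measure Ω}

/-- Shifting the environment by a translates the path by a. This cocycle identity is what turns
increments of the potential along a ray into Birkhoff sums. -/
theorem IsErgodicFamily.sum_shift (hT : IsErgodicFamily T P)
    (hω : ∀ (x : Fin d → ℤ) (γ : LatticePath x x), γ.sum T F ω = 0) (a : Fin d → ℤ)
    {x y : Fin d → ℤ} (γ : LatticePath x y) :
    γ.sum T F (shift T a ω) = pathPotential T F ω (a + y) - pathPotential T F ω (a + x) := by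
  induction γ with
  | nil _ => simp [LatticePath.sum]
  | @cons x y e γ ih =>
    rw [LatticePath.sum, ih, ← hT.shift_add, ← add_assoc, pathPotential_add_step hω, add_comm x a]
    ring

theorem LatticePath.measurable_sum (hT : IsErgodicFamily T P) (hF : ∀ e, Measurable fun ω => F ω e)
    {x y : Fin d → ℤ} (γ : LatticePath x y) : Measurable fun ω => γ.sum T F ω := by
  induction γ with
  | nil _ => exact measurable_const
  | cons e γ ih =>
    exact ((hF e).comp (hT.measurePreserving_shift _).measurable).add ih

theorem LatticePath.integrable_sum (hT : IsErgodicFamily T P)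
    (hF : ∀ e, Integrable (fun ω => F ω e) P)
    {x y : Fin d → ℤ} (γ : LatticePath x y) : Integrable (fun ω => γ.sum T F ω) P := by
  induction γ with
  | nil _ => exact integrable_zero _ _ _
  | @cons x y e γ ih =>
    exact ((hT.measurePreserving_shift x).integrable_comp_of_integrable (hF e)).add ih

theorem LatticePath.integral_sum (hT : IsErgodicFamily T P)
    (hF : ∀ e, Integrable (fun ω => F ω e) P) (h0 : ∀ e, ∫ ω, F ω e ∂P = 0)
    {x y : Fin d → ℤ} (γ : LatticePath x y) : ∫ ω, γ.sum T F ω ∂P = 0 := by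
  induction γ with
  | nil _ => simp [LatticePath.sum]
  | @cons x y e γ ih =>
    have hs := hT.measurePreserving_shift x
    have h1 : ∫ ω, F (shift T x ω) e ∂P = 0 := by
      rw [← h0 e]
      conv_rhs => rw [← hs.map_eq]
      refine (integral_map (f := fun ω => F ω e) hs.measurable.aemeasurable ?_).symm
      rw [hs.map_eq]
      exact (hF e).aestronglyMeasurable
    have h2 : Integrable (fun ω => F (shift T x ω) e) P :=
      hs.integrable_comp_of_integrable (hF e)
    simp only [LatticePath.sum]
    rw [integral_add h2 (γ.integrable_sum hT hF), h1, ih, add_zero]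

end PathSums

/-! ### A maximal inequality for averages over cubes. -/

section Maximal

/-- The cube of `ℤ^d` with centre `x` and side `2 r + 1`. -/
noncomputable def latticeBox {d : ℕ} (x : Fin d → ℤ) (r : ℕ) : Finset (Fin d → ℤ) :=
  Finset.Icc (fun i => x i - r) (fun i => x i + r)

variable {d : ℕ}

theorem mem_latticeBox {x y : Fin d → ℤ} {r : ℕ} :
    y ∈ latticeBox x r ↔ ∀ i, |y i - x i| ≤ r := by
  simp only [latticeBox, Finset.mem_Icc, Pi.le_def, ← forall_and, abs_le]
  refine forall_congr' fun i => ?_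
  constructor <;> rintro ⟨h1, h2⟩ <;> constructor <;> linarith

theorem coe_latticeBox (x : Fin d → ℤ) (r : ℕ) :
    (latticeBox x r : Set (Fin d → ℤ)) = Metric.closedBall x r := by
  ext y
  rw [Finset.mem_coe, mem_latticeBox, Metric.mem_closedBall, dist_pi_le_iff (by positivity)]
  refine forall_congr' fun i => ?_
  rw [Int.dist_eq]
  exact_mod_cast Iff.rfl

theorem card_latticeBox (x : Fin d → ℤ) (r : ℕ) : (latticeBox x r).card = (2 * r + 1) ^ d := by
  rw [latticeBox, Pi.card_Icc, Finset.prod_congr rfl (fun i _ => ?_), Finset.prod_const,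
    Finset.card_univ, Fintype.card_fin]
  rw [Int.card_Icc]
  omega

theorem sum_latticeBox {M : Type*} [AddCommMonoid M] (x : Fin d → ℤ) (r : ℕ)
    (φ : (Fin d → ℤ) → M) :
    ∑ u ∈ latticeBox x r, φ u = ∑ u ∈ latticeBox 0 r, φ (u + x) := by
  refine (Finset.sum_nbij' (fun u => u + x) (fun u => u - x) ?_ ?_ ?_ ?_ ?_).symm <;>
    simp [mem_latticeBox]

/-- Vitali covering argument: the number of centres of cubes in which the mean of `φ` is large. -/
theorem mul_card_le_of_le_sum_latticeBox (φ : (Fin d → ℤ) → ENNReal) (X : Finset (Fin d → ℤ))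
    (k : (Fin d → ℤ) → ℕ) {N L : ℕ} (hk : ∀ x ∈ X, k x ≤ N) (hX : X ⊆ latticeBox 0 L)
    (c : ENNReal) (h : ∀ x ∈ X, c * 2 ^ (k x * d) ≤ ∑ u ∈ latticeBox x (2 ^ k x), φ u) :
    c * X.card ≤ 11 ^ d * ∑ u ∈ latticeBox 0 (L + 2 ^ N), φ u := by
  -- Disjoint cubes are selected whose 5-fold enlargements cover X. An enlarged cube has side 10 ·
  -- 2^k + 1 ≤ 11 · 2^k, whence the factor 11^d.
  obtain ⟨u, huX, hdisj, hcov⟩ :=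
    Vitali.exists_disjoint_subfamily_covering_enlargement_closedBall (X : Set (Fin d → ℤ)) id
      (fun x => ((2 ^ k x : ℕ) : ℝ)) (2 ^ N)
      (fun x hx => by
        push_cast
        exact pow_le_pow_right₀ (by norm_num) (hk x hx)) 5 (by norm_num)
  have hfin : u.Finite := X.finite_toSet.subset huX
  lift u to Finset (Fin d → ℤ) using hfin
  simp only [id, ← coe_latticeBox] at hdisj hcov
  have huX' : u ⊆ X := by exact_mod_cast huX
  have hXu : X ⊆ u.biUnion fun b => latticeBox b (5 * 2 ^ k b) := by
    intro x hx
    obtain ⟨b, hb, hsub⟩ := hcov x hx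
    refine Finset.mem_biUnion.2 ⟨b, hb, ?_⟩
    rw [← Finset.mem_coe, coe_latticeBox]
    have := hsub (show x ∈ (latticeBox x (2 ^ k x) : Set (Fin d → ℤ)) by
      simp [mem_latticeBox])
    push_cast at this ⊢
    exact this
  have hcard : X.card ≤ ∑ b ∈ u, 11 ^ d * 2 ^ (k b * d) := by
    refine (Finset.card_le_card hXu).trans (Finset.card_biUnion_le.trans ?_)
    refine Finset.sum_le_sum fun b _ => ?_
    rw [card_latticeBox, pow_mul, ← mul_pow]
    refine Nat.pow_le_pow_left ?_ d
    have := Nat.one_le_two_pow (n := k b)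
    omega
  calc c * X.card ≤ c * ((∑ b ∈ u, 11 ^ d * 2 ^ (k b * d) : ℕ) : ENNReal) := by gcongr
    _ = 11 ^ d * ∑ b ∈ u, c * 2 ^ (k b * d) := by
        push_cast
        rw [← Finset.mul_sum, ← Finset.mul_sum]
        ring
    _ ≤ 11 ^ d * ∑ b ∈ u, ∑ w ∈ latticeBox b (2 ^ k b), φ w := by
        gcongr with b hb
        exact h b (huX' hb)
    _ = 11 ^ d * ∑ w ∈ u.biUnion (fun b => latticeBox b (2 ^ k b)), φ w := by
        rw [Finset.sum_biUnion]
        intro a ha b hb hab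
        exact Finset.disjoint_coe.1 (hdisj ha hb hab)
    _ ≤ 11 ^ d * ∑ w ∈ latticeBox 0 (L + 2 ^ N), φ w := by
        gcongr
        intro w hw
        obtain ⟨b, hb, hwb⟩ := Finset.mem_biUnion.1 hw
        rw [mem_latticeBox] at hwb ⊢
        have hb0 := mem_latticeBox.1 (hX (huX' hb))
        intro i
        have h1 := hwb i
        have h2 := hb0 i
        have h3 : ((2 ^ k b : ℕ) : ℤ) ≤ ((2 ^ N : ℕ) : ℤ) := by
          exact_mod_cast Nat.pow_le_pow_right (by norm_num) (hk b (huX' hb))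
        rw [abs_le] at h1 h2 ⊢
        simp only [Pi.zero_apply, sub_zero] at h2 ⊢
        push_cast at h1 h2 h3 ⊢
        constructor <;> linarith [h1.1, h1.2, h2.1, h2.2]

variable {Ω : Type*} [MeasurableSpace Ω] {T : UnitStep d → Ω → Ω} {P : Measure Ω}

/-- Weak type `(1,1)` inequality for averages over dyadic cubes of bounded size. -/
theorem IsErgodicFamily.mul_measure_exists_le (hT : IsErgodicFamily T P) {g : Ω → ENNReal}
    (hg : Measurable g) (c : ENNReal) (N : ℕ) :
    c * P {ω | ∃ k ≤ N, c * 2 ^ (k * d) ≤ ∑ u ∈ latticeBox 0 (2 ^ k), g (shift T u ω)} ≤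
      22 ^ d * ∫⁻ ω, g ω ∂P := by
  set E := {ω | ∃ k ≤ N, c * 2 ^ (k * d) ≤ ∑ u ∈ latticeBox 0 (2 ^ k), g (shift T u ω)} with hE
  have hsm : ∀ u, Measurable (shift T u) := fun u => (hT.measurePreserving_shift u).measurable
  have hEm : MeasurableSet E := by
    have : E = ⋃ k ∈ Set.Iic N,
        {ω | c * 2 ^ (k * d) ≤ ∑ u ∈ latticeBox 0 (2 ^ k), g (shift T u ω)} := by
      ext ω; simp [hE]
    rw [this]
    refine MeasurableSet.biUnion (Set.to_countable _) fun k _ => ?_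
    exact measurableSet_le measurable_const
      (Finset.measurable_sum _ fun u _ => hg.comp (hsm u))
  classical
  -- Transference: the covering bound is applied, for fixed ω, to the values of g along the orbit
  -- and to the visits of the orbit to E. Integration then replaces each summand by P E or by the
  -- integral of g.
  have key : ∀ ω, c * ∑ x ∈ latticeBox (0 : Fin d → ℤ) (2 ^ N), E.indicator 1 (shift T x ω) ≤
      11 ^ d * ∑ u ∈ latticeBox (0 : Fin d → ℤ) (2 ^ N + 2 ^ N), g (shift T u ω) := by
    intro ω
    have hch : ∀ x, ∃ k, shift T x ω ∈ E → k ≤ N ∧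
        c * 2 ^ (k * d) ≤ ∑ u ∈ latticeBox 0 (2 ^ k), g (shift T u (shift T x ω)) := fun x => by
      by_cases hx : shift T x ω ∈ E
      · obtain ⟨k, hk⟩ := hx
        exact ⟨k, fun _ => hk⟩
      · exact ⟨0, fun h => absurd h hx⟩
    choose k hk using hch
    have := mul_card_le_of_le_sum_latticeBox (fun u => g (shift T u ω))
      ((latticeBox (0 : Fin d → ℤ) (2 ^ N)).filter fun x => shift T x ω ∈ E) k (N := N)
      (L := 2 ^ N) (fun x hx => (hk x (Finset.mem_filter.1 hx).2).1)
      (Finset.filter_subset _ _) c (fun x hx => by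
        rw [sum_latticeBox]
        simp only [hT.shift_add]
        exact (hk x (Finset.mem_filter.1 hx).2).2)
    refine le_trans (le_of_eq ?_) this
    congr 1
    simp [Set.indicator_apply, Finset.card_filter]
  have hmeas2 : ∀ x, Measurable fun ω => g (shift T x ω) := fun x => hg.comp (hsm x)
  have hint := lintegral_mono (μ := P) key
  have hmeas1 : ∀ x, Measurable fun ω => E.indicator (1 : Ω → ENNReal) (shift T x ω) := fun x =>
    (measurable_one.indicator hEm).comp (hsm x)
  rw [lintegral_const_mul _ (Finset.measurable_sum _ fun x _ => hmeas1 x),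
    lintegral_const_mul _ (Finset.measurable_sum _ fun x _ => hmeas2 x),
    lintegral_finsetSum _ (fun x _ => hmeas1 x),
    lintegral_finsetSum _ (fun x _ => hmeas2 x)] at hint
  have h1 : ∀ x, ∫⁻ ω, E.indicator (1 : Ω → ENNReal) (shift T x ω) ∂P = P E := fun x => by
    rw [(hT.measurePreserving_shift x).lintegral_comp (measurable_one.indicator hEm),
      lintegral_indicator_one hEm]
  have h2 : ∀ x, ∫⁻ ω, g (shift T x ω) ∂P = ∫⁻ ω, g ω ∂P := fun x =>
    (hT.measurePreserving_shift x).lintegral_comp hg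
  simp only [h1, h2, Finset.sum_const, card_latticeBox, nsmul_eq_mul] at hint
  -- Enlarging the box of radius 2^N by the largest cube radius 2^N costs at most 2^d in
  -- cardinality, so the final constant is 11^d · 2^d = 22^d.
  have hcard : ((((2 * (2 ^ N + 2 ^ N) + 1) ^ d : ℕ)) : ENNReal) ≤
      2 ^ d * (((2 * 2 ^ N + 1) ^ d : ℕ) : ENNReal) := by
    have : (2 * (2 ^ N + 2 ^ N) + 1) ^ d ≤ 2 ^ d * (2 * 2 ^ N + 1) ^ d := by
      rw [← mul_pow]
      exact Nat.pow_le_pow_left (by omega) d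
    exact_mod_cast this
  set B : ENNReal := (((2 * 2 ^ N + 1) ^ d : ℕ) : ENNReal) with hB
  have hB0 : B ≠ 0 := by rw [hB]; exact_mod_cast (by positivity)
  have hBt : B ≠ ⊤ := ENNReal.natCast_ne_top _
  refine (ENNReal.mul_le_mul_iff_right hB0 hBt).1 ?_
  calc B * (c * P E) = c * (B * P E) := by ring
    _ ≤ _ := hint
    _ ≤ 11 ^ d * (2 ^ d * B * ∫⁻ ω, g ω ∂P) := by gcongr
    _ = B * (22 ^ d * ∫⁻ ω, g ω ∂P) := by
        rw [show (22 : ENNReal) = 11 * 2 by norm_num, mul_pow]; ring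

/-- The averages of an integrable function over dyadic cubes are almost surely bounded. -/
theorem IsErgodicFamily.ae_exists_sum_latticeBox_le (hT : IsErgodicFamily T P) {g : Ω → ENNReal}
    (hg : Measurable g) (hgi : ∫⁻ ω, g ω ∂P ≠ ⊤) :
    ∀ᵐ ω ∂P, ∃ M : ℕ, ∀ k : ℕ,
      ∑ u ∈ latticeBox 0 (2 ^ k), g (shift T u ω) ≤ M * 2 ^ (k * d) := by
  set E : ℕ → ℕ → Set Ω := fun M N =>
    {ω | ∃ k ≤ N, (M : ENNReal) * 2 ^ (k * d) ≤ ∑ u ∈ latticeBox 0 (2 ^ k), g (shift T u ω)} with hE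
  have hEN : ∀ M : ℕ, (M : ENNReal) * P (⋃ N, E M N) ≤ 22 ^ d * ∫⁻ ω, g ω ∂P := by
    intro M
    -- The weak type bound does not depend on N, so continuity from below removes the restriction on
    -- the size of the cubes.
    have hmono : Monotone (E M) := fun a b hab ω ⟨k, hk, h⟩ => ⟨k, hk.trans hab, h⟩
    rw [hmono.measure_iUnion, ENNReal.mul_iSup]
    exact iSup_le fun N => hT.mul_measure_exists_le hg M N
  have hzero : P (⋂ M : ℕ, ⋃ N, E M N) = 0 := by
    by_contra hne
    have hle : ∀ M : ℕ, (M : ENNReal) * P (⋂ M : ℕ, ⋃ N, E M N) ≤ 22 ^ d * ∫⁻ ω, g ω ∂P :=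
      fun M => le_trans (by gcongr; exact Set.iInter_subset _ M) (hEN M)
    have htop : 22 ^ d * ∫⁻ ω, g ω ∂P ≠ ⊤ := ENNReal.mul_ne_top (by simp) hgi
    obtain ⟨M, hM⟩ := ENNReal.exists_nat_mul_gt hne htop
    exact absurd hM (not_lt.2 (hle M))
  have : ∀ᵐ ω ∂P, ω ∉ ⋂ M : ℕ, ⋃ N, E M N := measure_eq_zero_iff_ae_notMem.1 hzero
  filter_upwards [this] with ω hω
  simp only [Set.mem_iInter, Set.mem_iUnion, hE, Set.mem_ofPred_eq, not_forall, not_exists,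
    not_and, not_le] at hω
  obtain ⟨M, hM⟩ := hω
  exact ⟨M, fun k => (hM k k le_rfl).le⟩

end Maximal

/-! ### A discrete Morrey inequality and uniform sublinearity. -/

section Morrey

variable {d : ℕ}

/-- The mean of `h` over the cube `z + [0, r)^d`. -/
noncomputable def boxAverage (r : ℕ) (h : (Fin d → ℤ) → ℝ) (z : Fin d → ℤ) : ℝ :=
  ((r : ℝ) ^ d)⁻¹ * ∑ w : Fin d → Fin r, h (z + fun i => ((w i : ℕ) : ℤ))

theorem boxAverage_one (h : (Fin d → ℤ) → ℝ) (z : Fin d → ℤ) : boxAverage 1 h z = h z := by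
  rw [boxAverage, Fintype.sum_unique]
  simp only [Nat.cast_one, one_pow, inv_one, one_mul]
  congr 1
  ext i
  simp

theorem boxAverage_comm (r s : ℕ) (h : (Fin d → ℤ) → ℝ) (z : Fin d → ℤ) :
    boxAverage r (boxAverage s h) z = boxAverage s (boxAverage r h) z := by
  simp only [boxAverage, ← Finset.mul_sum]
  rw [Finset.sum_comm, mul_left_comm]
  simp only [add_right_comm]

theorem boxAverage_sub_const {r : ℕ} (hr : 0 < r) (h : (Fin d → ℤ) → ℝ) (z : Fin d → ℤ) (c : ℝ) :
    boxAverage r h z - c =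
      ((r : ℝ) ^ d)⁻¹ * ∑ w : Fin d → Fin r, (h (z + fun i => ((w i : ℕ) : ℤ)) - c) := by
  have : (r : ℝ) ^ d ≠ 0 := by positivity
  rw [Finset.sum_sub_distrib, mul_sub, boxAverage]
  simp only [Finset.sum_const, Finset.card_univ, Fintype.card_fun, Fintype.card_fin, nsmul_eq_mul,
    Nat.cast_pow]
  rw [inv_mul_cancel_left₀ this]

/-- A monotone lattice path from z to z + w has as many steps as the sum of the coordinates of w and
stays in the box between them. -/
theorem abs_add_sub_le_of_gradient_le {h : (Fin d → ℤ) → ℝ} {G : ℝ} (z : Fin d → ℤ)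
    (w : Fin d → ℕ)
    (hG : ∀ x, (∀ i, z i ≤ x i ∧ x i ≤ z i + w i) → ∀ i, |h (x + Pi.single i 1) - h x| ≤ G) :
    |h (z + fun i => (w i : ℤ)) - h z| ≤ G * ∑ i, (w i : ℝ) := by
  induction hn : ∑ i, w i generalizing w with
  | zero =>
    have hw : w = 0 := funext fun i => (Finset.sum_eq_zero_iff.1 hn) i (Finset.mem_univ i)
    subst hw
    have : (z + fun i => (((0 : Fin d → ℕ) i : ℕ) : ℤ)) = z := by ext; simp
    rw [this]
    simp
  | succ n ih =>
    obtain ⟨i, hi⟩ : ∃ i, 0 < w i := by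
      by_contra! hcon
      have : ∑ i, w i = 0 := Finset.sum_eq_zero fun i _ => by simpa using hcon i
      omega
    obtain ⟨v, rfl⟩ : ∃ v : Fin d → ℕ, w = v + Pi.single i 1 :=
      ⟨w - Pi.single i 1, by
        ext j
        by_cases hj : j = i
        · subst hj; simp; omega
        · simp [hj]⟩
    have hsum : ∀ j, v j ≤ (v + Pi.single i 1 : Fin d → ℕ) j := fun j => by simp
    have hv : ∑ j, v j = n := by
      simp only [Pi.add_apply, Finset.sum_add_distrib, Finset.sum_pi_single', Finset.mem_univ,
        if_true] at hn
      omega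
    have h1 := ih v (fun x hx => hG x fun j => ⟨(hx j).1, (hx j).2.trans (by
      have := hsum j
      omega)⟩) hv
    have h2 := hG (z + fun j => (v j : ℤ)) (fun j => ⟨by simp, by
      have := hsum j
      simp only [Pi.add_apply] at this ⊢
      omega⟩) i
    have hz : (z + fun j => (((v + Pi.single i 1 : Fin d → ℕ) j : ℕ) : ℤ)) =
        (z + fun j => (v j : ℤ)) + Pi.single i 1 := by
      ext j
      by_cases hj : j = i
      · subst hj; simp [add_assoc]
      · simp [hj]
    have hs : ∑ j, (((v + Pi.single i 1 : Fin d → ℕ) j : ℕ) : ℝ) = ∑ j, (v j : ℝ) + 1 := by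
      rw [← Nat.cast_sum, hn, ← Nat.cast_sum, hv]; push_cast; ring
    rw [hz, hs]
    calc _ ≤ |h ((z + fun j => (v j : ℤ)) + Pi.single i 1) - h (z + fun j => (v j : ℤ))| +
          |h (z + fun j => (v j : ℤ)) - h z| := abs_sub_le _ _ _
      _ ≤ G * (∑ j, (v j : ℝ) + 1) := by linarith

theorem abs_boxAverage_sub_le {h : (Fin d → ℤ) → ℝ} {G : ℝ} (hG0 : 0 ≤ G) {s : ℕ} (hs : 0 < s)
    (z : Fin d → ℤ)
    (hG : ∀ x, (∀ i, z i ≤ x i ∧ x i ≤ z i + s) → ∀ i, |h (x + Pi.single i 1) - h x| ≤ G) :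
    |boxAverage s h z - h z| ≤ G * (d * s) := by
  have hsd : 0 < (s : ℝ) ^ d := by positivity
  rw [boxAverage_sub_const hs, abs_mul, abs_of_pos (inv_pos.2 hsd), inv_mul_le_iff₀ hsd]
  refine (Finset.abs_sum_le_sum_abs _ _).trans ?_
  have hterm : ∀ w : Fin d → Fin s,
      |h (z + fun i => ((w i : ℕ) : ℤ)) - h z| ≤ G * (d * s) := fun w => by
    refine (abs_add_sub_le_of_gradient_le z (fun i => (w i : ℕ)) fun x hx => hG x fun i =>
      ⟨(hx i).1, (hx i).2.trans (by have := (w i).2; omega)⟩).trans ?_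
    refine mul_le_mul_of_nonneg_left ?_ hG0
    calc ∑ i, (((w i : ℕ)) : ℝ) ≤ ∑ _i : Fin d, (s : ℝ) :=
          Finset.sum_le_sum fun i _ => by exact_mod_cast (w i).2.le
      _ = d * s := by simp
  refine (Finset.sum_le_sum fun w _ => hterm w).trans ?_
  simp

/-- Jensen's inequality for the uniform weights on the cube. -/
theorem abs_boxAverage_rpow_le {p : ℝ} (hp : 1 ≤ p) {r : ℕ} (hr : 0 < r)
    (h : (Fin d → ℤ) → ℝ) (x : Fin d → ℤ) (Q : Finset (Fin d → ℤ))
    (hQ : ∀ u, (∀ i, x i ≤ u i ∧ u i ≤ x i + r) → u ∈ Q) :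
    |boxAverage r h x| ^ p ≤ ((r : ℝ) ^ d)⁻¹ * ∑ u ∈ Q, |h u| ^ p := by
  have hrd : 0 < (r : ℝ) ^ d := by positivity
  have h1 : |boxAverage r h x| ≤
      ∑ w : Fin d → Fin r, ((r : ℝ) ^ d)⁻¹ * |h (x + fun i => ((w i : ℕ) : ℤ))| := by
    rw [← Finset.mul_sum, boxAverage, abs_mul, abs_of_pos (inv_pos.2 hrd)]
    gcongr
    exact Finset.abs_sum_le_sum_abs _ _
  have h2 := Real.rpow_arith_mean_le_arith_mean_rpow (Finset.univ : Finset (Fin d → Fin r))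
    (fun _ => ((r : ℝ) ^ d)⁻¹) (fun w => |h (x + fun i => ((w i : ℕ) : ℤ))|)
    (fun _ _ => by positivity) (by simp [hrd.ne']) (fun _ _ => abs_nonneg _) hp
  refine (Real.rpow_le_rpow (abs_nonneg _) h1 (by linarith)).trans (h2.trans ?_)
  rw [← Finset.mul_sum]
  gcongr
  classical
  have hinj : Function.Injective fun w : Fin d → Fin r => x + fun i => ((w i : ℕ) : ℤ) := by
    intro a b hab
    ext i
    have := congrFun hab i
    simpa using this
  rw [← Finset.sum_image (f := fun u => |h u| ^ p)
    (g := fun w : Fin d → Fin r => x + fun i => ((w i : ℕ) : ℤ)) (hinj.injOn)]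
  refine Finset.sum_le_sum_of_subset_of_nonneg ?_ fun _ _ _ => by positivity
  intro u hu
  obtain ⟨w, -, rfl⟩ := Finset.mem_image.1 hu
  refine hQ _ fun i => ?_
  have := (w i).2
  simp only [Pi.add_apply]
  omega

/-- The sum over `Q` of the `p`-th powers of the increments of `f` along the coordinate
directions. -/
noncomputable def gradientEnergy (f : (Fin d → ℤ) → ℝ) (p : ℝ) (Q : Finset (Fin d → ℤ)) : ℝ :=
  ∑ u ∈ Q, ∑ i, |f (u + Pi.single i 1) - f u| ^ p

theorem gradientEnergy_nonneg (f : (Fin d → ℤ) → ℝ) (p : ℝ) (Q : Finset (Fin d → ℤ)) :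
    0 ≤ gradientEnergy f p Q :=
  Finset.sum_nonneg fun _ _ => Finset.sum_nonneg fun _ _ => by positivity

variable {f : (Fin d → ℤ) → ℝ} {p : ℝ} {Q : Finset (Fin d → ℤ)}

/-- Averaging commutes with differences, so Jensen's inequality bounds the gradient of the average
by the energy. The cube volume 2^(kd) enters through its p-th root. -/
theorem abs_boxAverage_add_single_sub_le (hp : 1 ≤ p) (k : ℕ) (x : Fin d → ℤ)
    (hQ : ∀ u, (∀ i, x i ≤ u i ∧ u i ≤ x i + (2 ^ k : ℕ)) → u ∈ Q) (i : Fin d) :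
    |boxAverage (2 ^ k) f (x + Pi.single i 1) - boxAverage (2 ^ k) f x| ≤
      gradientEnergy f p Q ^ (1 / p) / ((2 : ℝ) ^ (d / p)) ^ k := by
  have hp0 : 0 < p := by linarith
  have hS := gradientEnergy_nonneg f p Q
  have heq : boxAverage (2 ^ k) f (x + Pi.single i 1) - boxAverage (2 ^ k) f x =
      boxAverage (2 ^ k) (fun u => f (u + Pi.single i 1) - f u) x := by
    simp only [boxAverage, ← mul_sub, ← Finset.sum_sub_distrib, add_right_comm]
  rw [heq]
  refine (Real.rpow_le_rpow_iff (abs_nonneg _) (by positivity) hp0).1 ?_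
  refine (abs_boxAverage_rpow_le hp (by positivity) _ x Q hQ).trans ?_
  have hpow : (((2 : ℝ) ^ ((d : ℝ) / p)) ^ k) ^ p = ((2 ^ k : ℕ) : ℝ) ^ d := by
    rw [← Real.rpow_natCast _ k, ← Real.rpow_mul (by positivity), ← Real.rpow_mul (by positivity),
      show (d : ℝ) / p * (k * p) = ((k * d : ℕ) : ℝ) by push_cast; field_simp, Real.rpow_natCast]
    push_cast
    rw [pow_mul]
  rw [Real.div_rpow (by positivity) (by positivity), ← Real.rpow_mul hS,
    one_div_mul_cancel hp0.ne', Real.rpow_one, hpow, div_eq_inv_mul]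
  unfold gradientEnergy
  gcongr
  exact Finset.single_le_sum (f := fun i => |f (_ + Pi.single i 1) - f _| ^ p)
    (fun _ _ => by positivity) (Finset.mem_univ i)

/-- Both averages are compared with the iterated average over the two scales, which does not depend
on the order of averaging. Each comparison uses the gradient bound for an averaged function; the
distances 2^(k+1) and 2^k add up to the factor 3. -/
theorem abs_boxAverage_succ_sub_le (hp : 1 ≤ p) (k : ℕ) (z : Fin d → ℤ)
    (hQ : ∀ u, (∀ i, z i ≤ u i ∧ u i ≤ z i + (2 ^ (k + 2) : ℕ)) → u ∈ Q) :
    |boxAverage (2 ^ (k + 1)) f z - boxAverage (2 ^ k) f z| ≤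
      3 * d * gradientEnergy f p Q ^ (1 / p) * (2 / (2 : ℝ) ^ (d / p)) ^ k := by
  have hp0 : 0 < p := by linarith
  have hS := gradientEnergy_nonneg f p Q
  set σ := gradientEnergy f p Q ^ (1 / p) with hσ
  have hσ0 : 0 ≤ σ := by positivity
  set β := (2 : ℝ) ^ ((d : ℝ) / p) with hβ
  have hβ1 : 1 ≤ β := Real.one_le_rpow (by norm_num) (by positivity)
  have h2k : 2 ^ (k + 2) = 2 ^ k * 4 := by ring
  have h2k1 : 2 ^ (k + 1) = 2 ^ k * 2 := by ring
  have h1 : |boxAverage (2 ^ (k + 1)) (boxAverage (2 ^ k) f) z - boxAverage (2 ^ k) f z| ≤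
      σ / β ^ k * (d * (2 ^ (k + 1) : ℕ)) := by
    refine abs_boxAverage_sub_le (by positivity) (by positivity) z fun x hx i => ?_
    refine abs_boxAverage_add_single_sub_le hp k x (fun u hu => hQ u fun j => ?_) i
    have := hx j
    have := hu j
    omega
  have h2 : |boxAverage (2 ^ k) (boxAverage (2 ^ (k + 1)) f) z - boxAverage (2 ^ (k + 1)) f z| ≤
      σ / β ^ (k + 1) * (d * (2 ^ k : ℕ)) := by
    refine abs_boxAverage_sub_le (by positivity) (by positivity) z fun x hx i => ?_
    refine abs_boxAverage_add_single_sub_le hp (k + 1) x (fun u hu => hQ u fun j => ?_) i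
    have := hx j
    have := hu j
    omega
  rw [boxAverage_comm] at h2
  have h3 : σ / β ^ (k + 1) ≤ σ / β ^ k := by gcongr; omega
  have h4 : σ / β ^ (k + 1) * (d * (2 ^ k : ℕ)) ≤ σ / β ^ k * (d * (2 ^ k : ℕ)) := by gcongr
  calc _ ≤ |boxAverage (2 ^ (k + 1)) (boxAverage (2 ^ k) f) z - boxAverage (2 ^ k) f z| +
        |boxAverage (2 ^ (k + 1)) (boxAverage (2 ^ k) f) z - boxAverage (2 ^ (k + 1)) f z| := by
        rw [abs_sub_comm _ (boxAverage (2 ^ (k + 1)) f z)]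
        refine (abs_sub_le _ _ _).trans (le_of_eq (add_comm _ _))
    _ ≤ σ / β ^ k * (d * (2 ^ (k + 1) : ℕ)) + σ / β ^ k * (d * (2 ^ k : ℕ)) := by linarith
    _ = 3 * d * σ * (2 / β) ^ k := by
        rw [div_pow, pow_succ]
        push_cast
        field_simp
        ring

theorem one_lt_two_div_two_rpow_div {a p : ℝ} (hp : 0 < p) (hap : a < p) :
    1 < 2 / (2 : ℝ) ^ (a / p) := by
  rw [one_lt_div (by positivity)]
  calc (2 : ℝ) ^ (a / p) < 2 ^ (1 : ℝ) :=
        Real.rpow_lt_rpow_of_exponent_lt (by norm_num) ((div_lt_one hp).2 hap)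
    _ = 2 := Real.rpow_one 2

/-- Telescoping over the scales from 1 to 2^m. The ratio of the geometric series exceeds 1 exactly
because p > d, so the largest scale dominates. -/
theorem abs_boxAverage_sub_self_le (hp : 1 ≤ p) (hdp : d < p) (m : ℕ) (z : Fin d → ℤ)
    (hQ : ∀ u, (∀ i, z i ≤ u i ∧ u i ≤ z i + (2 * 2 ^ m : ℕ)) → u ∈ Q) :
    |boxAverage (2 ^ m) f z - f z| ≤ 3 * d * gradientEnergy f p Q ^ (1 / p) *
      ((2 / (2 : ℝ) ^ (d / p)) ^ m / (2 / (2 : ℝ) ^ (d / p) - 1)) := by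
  have hp0 : 0 < p := by linarith
  have hS := gradientEnergy_nonneg f p Q
  set θ := 2 / (2 : ℝ) ^ ((d : ℝ) / p) with hθ
  have hθ1 : 1 < θ := one_lt_two_div_two_rpow_div hp0 hdp
  have hsum : ∀ n ≤ m, |boxAverage (2 ^ n) f z - f z| ≤
      ∑ k ∈ Finset.range n, 3 * d * gradientEnergy f p Q ^ (1 / p) * θ ^ k := by
    intro n
    induction n with
    | zero => intro _; simp [boxAverage_one]
    | succ n ih =>
      intro hn
      rw [Finset.sum_range_succ]
      have h1 := abs_boxAverage_succ_sub_le (f := f) (Q := Q) hp n z fun u hu => hQ u fun j => by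
        have := hu j
        have h2 : 2 ^ (n + 1) ≤ 2 ^ m := Nat.pow_le_pow_right (by norm_num) hn
        have h3 : 2 ^ (n + 2) = 2 * 2 ^ (n + 1) := by ring
        omega
      have h2 := ih (by omega)
      have h3 := abs_sub_le (boxAverage (2 ^ (n + 1)) f z) (boxAverage (2 ^ n) f z) (f z)
      linarith
  refine (hsum m le_rfl).trans ?_
  rw [← Finset.mul_sum, geom_sum_eq hθ1.ne']
  have : 0 < θ - 1 := by linarith
  gcongr
  linarith

/-- A discrete Morrey inequality. -/
theorem exists_abs_add_sub_le_gradientEnergy (hp : 1 ≤ p) (hdp : d < p) :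
    ∃ C : ℝ, 0 ≤ C ∧ ∀ (f : (Fin d → ℤ) → ℝ) (Q : Finset (Fin d → ℤ)) (m : ℕ) (z : Fin d → ℤ)
      (w : Fin d → ℕ), (∀ i, w i ≤ 2 ^ m) →
      (∀ u, (∀ i, z i ≤ u i ∧ u i ≤ z i + (3 * 2 ^ m : ℕ)) → u ∈ Q) →
      |f (z + fun i => (w i : ℤ)) - f z| ≤
        C * gradientEnergy f p Q ^ (1 / p) * (2 / (2 : ℝ) ^ (d / p)) ^ m := by
  have hp0 : 0 < p := by linarith
  set β := (2 : ℝ) ^ ((d : ℝ) / p) with hβ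
  have hβ0 : 0 < β := by positivity
  have hθ1 : 1 < 2 / β := one_lt_two_div_two_rpow_div hp0 hdp
  have hθ0 : 0 < 2 / β - 1 := by linarith
  -- The first term comes from comparing `f` with its average at both endpoints, the second from
  -- moving the average from z to z + w.
  refine ⟨6 * d / (2 / β - 1) + d, by positivity, fun f Q m z w hw hQ => ?_⟩
  have hS := gradientEnergy_nonneg f p Q
  set σ := gradientEnergy f p Q ^ (1 / p) with hσ
  have hσ0 : 0 ≤ σ := by positivity
  set y : Fin d → ℤ := z + fun i => (w i : ℤ) with hy
  have h1 := abs_boxAverage_sub_self_le (f := f) (Q := Q) hp hdp m z fun u hu => hQ u fun j => by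
    have := hu j
    omega
  have h2 := abs_boxAverage_sub_self_le (f := f) (Q := Q) hp hdp m y fun u hu => hQ u fun j => by
    have := hu j
    have := hw j
    simp only [hy, Pi.add_apply] at *
    omega
  have h3 : |boxAverage (2 ^ m) f y - boxAverage (2 ^ m) f z| ≤
      σ / β ^ m * ∑ i, (w i : ℝ) := by
    refine abs_add_sub_le_of_gradient_le z w fun x hx i => ?_
    refine abs_boxAverage_add_single_sub_le hp m x (fun u hu => hQ u fun j => ?_) i
    have := hx j
    have := hu j
    have := hw j
    omega
  have h4 : σ / β ^ m * ∑ i, (w i : ℝ) ≤ σ / β ^ m * (d * 2 ^ m) := by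
    gcongr
    calc ∑ i, (w i : ℝ) ≤ ∑ _i : Fin d, (2 : ℝ) ^ m :=
          Finset.sum_le_sum fun i _ => by exact_mod_cast hw i
      _ = d * 2 ^ m := by simp
  have h5 : σ / β ^ m * (d * 2 ^ m) = d * σ * (2 / β) ^ m := by
    rw [div_pow]; field_simp
  rw [← hβ, ← hσ] at h1 h2
  have h6 : |f y - f z| ≤ |boxAverage (2 ^ m) f y - f y| +
      |boxAverage (2 ^ m) f y - boxAverage (2 ^ m) f z| + |boxAverage (2 ^ m) f z - f z| := by
    rw [abs_sub_comm _ (f y)]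
    exact (abs_sub_le _ (boxAverage (2 ^ m) f z) _).trans (by gcongr; exact abs_sub_le _ _ _)
  calc |f y - f z| ≤ 3 * d * σ * ((2 / β) ^ m / (2 / β - 1)) + d * σ * (2 / β) ^ m +
        3 * d * σ * ((2 / β) ^ m / (2 / β - 1)) := by linarith
    _ = _ := by field_simp; ring

/-- A function with bounded mean `p`-energy on dyadic cubes, `p > d`, which is sublinear along
every ray, is uniformly sublinear. -/
theorem eventually_abs_le_of_gradientEnergy_le (hp : 1 ≤ p) (hdp : d < p) (f : (Fin d → ℤ) → ℝ)
    {M : ℝ} (hM0 : 0 ≤ M)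
    (hM : ∀ k : ℕ, gradientEnergy f p (latticeBox 0 (2 ^ k)) ≤ M * 2 ^ (k * d))
    (hray : ∀ v : Fin d → ℤ, Tendsto (fun k : ℕ => f (k • v) / k) atTop (𝓝 0))
    {ε : ℝ} (hε : 0 < ε) :
    ∀ᶠ n : ℕ in atTop, ∀ z ∈ latticeBox (0 : Fin d → ℤ) (2 ^ n), |f z| ≤ ε * 2 ^ n := by
  obtain ⟨C, hC0, hC⟩ := exists_abs_add_sub_le_gradientEnergy (d := d) hp hdp
  have hp0 : 0 < p := by linarith
  set β := (2 : ℝ) ^ ((d : ℝ) / p) with hβ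
  have hβ0 : 0 < β := by positivity
  have hθ1 : 1 < 2 / β := one_lt_two_div_two_rpow_div hp0 hdp
  have hβk : ∀ k : ℕ, ((2 : ℝ) ^ (k * d)) ^ (1 / p) = β ^ k := fun k => by
    rw [← Real.rpow_natCast, ← Real.rpow_natCast _ k, ← Real.rpow_mul (by norm_num),
      ← Real.rpow_mul (by norm_num)]
    congr 1
    push_cast
    field_simp
  -- The number j of scales between grid and cube is fixed so that the Morrey error is at most half
  -- of the allowance. Being independent of n, it leaves only finitely many rays.
  obtain ⟨j, hj⟩ := pow_unbounded_of_one_lt (C * (M ^ (1 / p) * β ^ 2) / (ε / 2)) hθ1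
  have hray' : ∀ v : Fin d → ℤ, ∀ᶠ n : ℕ in atTop, |f (2 ^ n • v)| ≤ ε / 2 * 2 ^ n := fun v => by
    have h1 : Tendsto (fun n : ℕ => 2 ^ n) atTop atTop :=
      tendsto_pow_atTop_atTop_of_one_lt (by norm_num : 1 < 2)
    have h2 := ((hray v).comp h1).abs
    simp only [abs_zero] at h2
    filter_upwards [h2.eventually_le_const (half_pos hε)] with n hn
    simp only [Function.comp_apply, abs_div] at hn
    rw [div_le_iff₀ (by positivity)] at hn
    simpa using hn
  have hall : ∀ᶠ n : ℕ in atTop, ∀ v ∈ latticeBox (0 : Fin d → ℤ) (2 ^ j),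
      |f (2 ^ n • v)| ≤ ε / 2 * 2 ^ n := by
    rw [Finset.eventually_all]
    exact fun v _ => hray' v
  obtain ⟨n₀, hn₀⟩ := eventually_atTop.1 hall
  filter_upwards [eventually_ge_atTop (n₀ + j)] with n hn z hz
  obtain ⟨m, rfl⟩ : ∃ m, n = m + j := ⟨n - j, by omega⟩
  have hz' := mem_latticeBox.1 hz
  simp only [Pi.zero_apply, sub_zero] at hz'
  -- Coordinatewise division with remainder by 2^m: the grid point 2^m v lies on a ray, and w is the
  -- displacement inside its cell.
  set v : Fin d → ℤ := fun i => z i / 2 ^ m with hv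
  set w : Fin d → ℕ := fun i => (z i % 2 ^ m).toNat with hw
  have h2m : (0 : ℤ) < 2 ^ m := by positivity
  have hwz : ∀ i, (w i : ℤ) = z i % 2 ^ m := fun i => Int.toNat_of_nonneg (Int.emod_nonneg _ h2m.ne')
  have hwlt : ∀ i, (w i : ℤ) < 2 ^ m := fun i => by rw [hwz]; exact Int.emod_lt_of_pos _ h2m
  have hdecomp : ∀ i, 2 ^ m * v i + w i = z i := fun i => by
    rw [hwz]; exact Int.mul_ediv_add_emod _ _
  have hzvw : z = 2 ^ m • v + fun i => (w i : ℤ) := by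
    ext i
    simp [hdecomp i]
  have hvbox : v ∈ latticeBox (0 : Fin d → ℤ) (2 ^ j) := by
    rw [mem_latticeBox]
    intro i
    have h1 := abs_le.1 (hz' i)
    have h2 : ((2 ^ (m + j) : ℕ) : ℤ) = 2 ^ m * 2 ^ j := by push_cast; ring
    rw [h2] at h1
    simp only [Pi.zero_apply, sub_zero, abs_le]
    push_cast
    constructor
    · rw [hv, Int.le_ediv_iff_mul_le h2m]
      linarith [h1.1]
    · exact Int.ediv_le_of_le_mul h2m (by linarith [h1.2])
  have h1 := hn₀ m (by omega) v hvbox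
  have h2 := hC f (latticeBox 0 (2 ^ (m + j + 2))) m (2 ^ m • v) w
    (fun i => by exact_mod_cast (hwlt i).le) (fun u hu => by
      rw [mem_latticeBox]
      intro i
      have h3 := hu i
      have h4 := abs_le.1 (hz' i)
      have h5 := hdecomp i
      have h6 := hwlt i
      have h7 : (2 : ℤ) ^ m ≤ 2 ^ (m + j) := pow_le_pow_right₀ (by norm_num) (by omega)
      have h8 : (2 : ℤ) ^ (m + j + 2) = 4 * 2 ^ (m + j) := by ring
      have h9 : (2 ^ m • v) i = 2 ^ m * v i := by simp
      rw [h9] at h3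
      simp only [Pi.zero_apply, sub_zero, abs_le]
      push_cast at h3 h4 ⊢
      constructor <;> linarith [h3.1, h3.2, h4.1, h4.2, Int.natCast_nonneg (w i)])
  rw [← hzvw] at h2
  have hσ : gradientEnergy f p (latticeBox 0 (2 ^ (m + j + 2))) ^ (1 / p) ≤
      M ^ (1 / p) * β ^ (m + j + 2) := by
    rw [← hβk, ← Real.mul_rpow hM0 (by positivity)]
    exact Real.rpow_le_rpow (gradientEnergy_nonneg _ _ _) (hM _) (by positivity)
  have h3 : C * gradientEnergy f p (latticeBox 0 (2 ^ (m + j + 2))) ^ (1 / p) * (2 / β) ^ m ≤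
      ε / 2 * 2 ^ (m + j) := by
    have hj' : C * (M ^ (1 / p) * β ^ 2) ≤ (2 / β) ^ j * (ε / 2) := by
      rw [div_lt_iff₀ (by positivity)] at hj
      exact hj.le
    calc _ ≤ C * (M ^ (1 / p) * β ^ (m + j + 2)) * (2 / β) ^ m := by gcongr
      _ = C * (M ^ (1 / p) * β ^ 2) * (β ^ (m + j) * (2 / β) ^ m) := by ring
      _ ≤ (2 / β) ^ j * (ε / 2) * (β ^ (m + j) * (2 / β) ^ m) := by gcongr
      _ = ε / 2 * 2 ^ (m + j) := by
        rw [div_pow, div_pow, pow_add, pow_add]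
        field_simp
  have h4 : ε / 2 * (2 : ℝ) ^ m ≤ ε / 2 * 2 ^ (m + j) := by
    gcongr
    · norm_num
    · omega
  have h5 := abs_sub_abs_le_abs_sub (f z) (f (2 ^ m • v))
  linarith

/-- Increments of such a function are sublinear along rays. -/
theorem tendsto_increment_div_of_gradientEnergy_le (hp : 1 ≤ p) (hdp : d < p)
    (f : (Fin d → ℤ) → ℝ) {M : ℝ} (hM0 : 0 ≤ M)
    (hM : ∀ k : ℕ, gradientEnergy f p (latticeBox 0 (2 ^ k)) ≤ M * 2 ^ (k * d))
    (v : Fin d → ℤ) (i : Fin d) :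
    Tendsto (fun k : ℕ => (f (k • v + Pi.single i 1) - f (k • v)) / k) atTop (𝓝 0) := by
  have hp0 : 0 < p := by linarith
  -- The added 1 keeps k V positive when v = 0.
  set V : ℕ := l1norm v + 1 with hV
  have hbound : ∀ k : ℕ, 0 < k → |f (k • v + Pi.single i 1) - f (k • v)| ≤
      (M * (2 * V) ^ d) ^ (1 / p) * (k : ℝ) ^ ((d : ℝ) / p) := by
    intro k hk
    set m := Nat.clog 2 (k * V) with hm
    have h1 : k * V ≤ 2 ^ m := Nat.le_pow_clog (by norm_num) _
    have h2 : 2 ^ m ≤ 2 * (k * V) := by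
      rcases Nat.eq_zero_or_pos m with h | h
      · rw [h]
        have : 0 < k * V := by positivity
        omega
      · have h3 : 2 ^ m.pred < k * V := by
          refine Nat.pow_pred_clog_lt_self (by norm_num) ?_
          by_contra hle
          have : m = 0 := Nat.clog_of_right_le_one (by omega) _
          omega
        have h4 : 2 ^ m = 2 * 2 ^ m.pred := by
          rw [← pow_succ', Nat.pred_eq_sub_one, Nat.sub_add_cancel h]
        omega
    have hmem : k • v ∈ latticeBox (0 : Fin d → ℤ) (2 ^ m) := by
      rw [mem_latticeBox]
      intro a
      have h3 : (v a).natAbs ≤ l1norm v :=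
        Finset.single_le_sum (f := fun a => (v a).natAbs) (fun _ _ => Nat.zero_le _)
          (Finset.mem_univ a)
      have h4 : |v a| ≤ V := by rw [Int.abs_eq_natAbs]; exact_mod_cast h3.trans (Nat.le_succ _)
      simp only [Pi.zero_apply, sub_zero, Pi.smul_apply, nsmul_eq_mul, abs_mul, Nat.abs_cast]
      calc (k : ℤ) * |v a| ≤ k * V := by gcongr
        _ ≤ ((2 ^ m : ℕ) : ℤ) := by exact_mod_cast h1
    have h3 : |f (k • v + Pi.single i 1) - f (k • v)| ^ p ≤ M * 2 ^ (m * d) := by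
      refine le_trans ?_ (hM m)
      refine le_trans ?_ (Finset.single_le_sum
        (f := fun u => ∑ i, |f (u + Pi.single i 1) - f u| ^ p)
        (fun _ _ => Finset.sum_nonneg fun _ _ => by positivity) hmem)
      exact Finset.single_le_sum (f := fun i => |f (k • v + Pi.single i 1) - f (k • v)| ^ p)
        (fun _ _ => by positivity) (Finset.mem_univ i)
    have h4 : M * 2 ^ (m * d) ≤ M * (2 * V) ^ d * (k : ℝ) ^ d := by
      rw [pow_mul, mul_assoc, ← mul_pow]
      gcongr
      have : (2 : ℝ) ^ m ≤ 2 * (k * V) := by exact_mod_cast h2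
      linarith
    have h5 := Real.rpow_le_rpow (by positivity) (h3.trans h4) (by positivity : 0 ≤ 1 / p)
    rw [← Real.rpow_mul (abs_nonneg _), mul_one_div_cancel hp0.ne', Real.rpow_one,
      Real.mul_rpow (by positivity) (by positivity), ← Real.rpow_natCast (k : ℝ) d,
      ← Real.rpow_mul (by positivity), mul_one_div] at h5
    exact h5
  -- One increment is at most the p-th root of the energy of a cube of radius comparable to k, hence
  -- of order k^(d/p), which is o(k) since d < p.
  refine squeeze_zero_norm' (a := fun k : ℕ =>
    (M * (2 * V) ^ d) ^ (1 / p) * (k : ℝ) ^ (-(1 - (d : ℝ) / p))) ?_ ?_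
  · filter_upwards [eventually_gt_atTop 0] with k hk
    have hk' : (0 : ℝ) < k := by exact_mod_cast hk
    rw [Real.norm_eq_abs, abs_div, abs_of_pos hk', div_le_iff₀ hk', mul_assoc]
    refine (hbound k hk).trans (le_of_eq ?_)
    congr 1
    nth_rewrite 3 [← Real.rpow_one (k : ℝ)]
    rw [← Real.rpow_add hk']
    congr 1
    ring
  · have h1 : 0 < 1 - (d : ℝ) / p := by
      have := (div_lt_one hp0).2 hdp
      linarith
    simpa using ((tendsto_rpow_neg_atTop h1).comp tendsto_natCast_atTop_atTop).const_mul
      ((M * (2 * V) ^ d) ^ (1 / p))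

end Morrey

/-! ### The maximal ergodic theorem for one transformation. -/

section MaximalErgodic

variable {Ω : Type*} {U : Ω → Ω} {h : Ω → ℝ}

/-- The maximum of the Birkhoff sums of `h` of length at most `n`, the empty sum included. -/
noncomputable def maxBirkhoffSum (U : Ω → Ω) (h : Ω → ℝ) : ℕ → Ω → ℝ
  | 0, _ => 0
  | n + 1, ω => max 0 (h ω + maxBirkhoffSum U h n (U ω))

theorem maxBirkhoffSum_nonneg (n : ℕ) (ω : Ω) : 0 ≤ maxBirkhoffSum U h n ω := by
  cases n with
  | zero => exact le_rfl
  | succ n => exact le_max_left _ _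

theorem maxBirkhoffSum_le_succ (n : ℕ) (ω : Ω) :
    maxBirkhoffSum U h n ω ≤ maxBirkhoffSum U h (n + 1) ω := by
  induction n generalizing ω with
  | zero => exact le_max_left _ _
  | succ n ih => exact max_le_max le_rfl (add_le_add le_rfl (ih _))

theorem birkhoffSum_le_maxBirkhoffSum (n : ℕ) (ω : Ω) :
    birkhoffSum U h n ω ≤ maxBirkhoffSum U h n ω := by
  induction n generalizing ω with
  | zero => simp [maxBirkhoffSum]
  | succ n ih =>
    rw [birkhoffSum_succ']
    exact (add_le_add le_rfl (ih _)).trans (le_max_right _ _)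

theorem birkhoffSum_neg' (k : ℕ) (ω : Ω) :
    birkhoffSum U (fun ω => -h ω) k ω = -birkhoffSum U h k ω := by
  simp [birkhoffSum]

variable [MeasurableSpace Ω] {P : Measure Ω}

theorem integrable_maxBirkhoffSum (hU : MeasurePreserving U P P) (hi : Integrable h P) (n : ℕ) :
    Integrable (maxBirkhoffSum U h n) P := by
  induction n with
  | zero => exact integrable_zero _ _ _
  | succ n ih =>
    exact (integrable_zero _ _ _).sup (hi.add (hU.integrable_comp_of_integrable ih))

theorem measurable_maxBirkhoffSum (hU : Measurable U) (hm : Measurable h) (n : ℕ) :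
    Measurable (maxBirkhoffSum U h n) := by
  induction n with
  | zero => exact measurable_const
  | succ n ih => exact measurable_const.max (hm.add (ih.comp hU))

/-- The maximal ergodic inequality for Birkhoff sums of bounded length. -/
theorem setIntegral_maxBirkhoffSum_pos_nonneg (hU : MeasurePreserving U P P) (hm : Measurable h)
    (hi : Integrable h P) (n : ℕ) :
    0 ≤ ∫ ω in {ω | 0 < maxBirkhoffSum U h (n + 1) ω}, h ω ∂P := by
  set A := {ω | 0 < maxBirkhoffSum U h (n + 1) ω} with hA
  have hAm : MeasurableSet A :=
    measurableSet_lt measurable_const (measurable_maxBirkhoffSum hU.measurable hm (n + 1))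
  have hI := integrable_maxBirkhoffSum hU hi
  have hIU : Integrable (fun ω => maxBirkhoffSum U h n (U ω)) P :=
    hU.integrable_comp_of_integrable (hI n)
  -- On A the positive maximum is the nonzero entry, so h is the maximum minus the shorter maximum
  -- along `U`. Off A the maximum vanishes; invariance of P and monotonicity in n then give the
  -- sign.
  have h1 : ∫ ω in A, (maxBirkhoffSum U h (n + 1) ω - maxBirkhoffSum U h n (U ω)) ∂P ≤
      ∫ ω in A, h ω ∂P := by
    refine setIntegral_mono_on ((hI (n + 1)).sub hIU).integrableOn hi.integrableOn hAm
      fun ω hω => ?_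
    have h2 : max 0 (h ω + maxBirkhoffSum U h n (U ω)) = h ω + maxBirkhoffSum U h n (U ω) :=
      max_eq_right (lt_max_iff.1 hω |>.resolve_left (lt_irrefl 0)).le
    have h3 : maxBirkhoffSum U h (n + 1) ω = h ω + maxBirkhoffSum U h n (U ω) := h2
    linarith
  refine le_trans ?_ h1
  rw [integral_sub (hI (n + 1)).integrableOn hIU.integrableOn]
  have h2 : ∫ ω in A, maxBirkhoffSum U h (n + 1) ω ∂P = ∫ ω, maxBirkhoffSum U h (n + 1) ω ∂P := by
    refine setIntegral_eq_integral_of_forall_compl_eq_zero fun ω hω => ?_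
    exact le_antisymm (not_lt.1 hω) (maxBirkhoffSum_nonneg _ _)
  have h3 : ∫ ω in A, maxBirkhoffSum U h n (U ω) ∂P ≤ ∫ ω, maxBirkhoffSum U h n (U ω) ∂P :=
    setIntegral_le_integral hIU (ae_of_all _ fun ω => maxBirkhoffSum_nonneg _ _)
  have h4 : ∫ ω, maxBirkhoffSum U h n (U ω) ∂P = ∫ ω, maxBirkhoffSum U h n ω ∂P := by
    conv_rhs => rw [← hU.map_eq]
    refine (integral_map hU.measurable.aemeasurable ?_).symm
    exact (measurable_maxBirkhoffSum hU.measurable hm n).aestronglyMeasurable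
  have h5 : ∫ ω, maxBirkhoffSum U h n ω ∂P ≤ ∫ ω, maxBirkhoffSum U h (n + 1) ω ∂P :=
    integral_mono (hI n) (hI (n + 1)) fun ω => maxBirkhoffSum_le_succ n ω
  linarith

/-- **Maximal ergodic theorem** in the case where almost every orbit has a positive Birkhoff
sum. -/
theorem integral_nonneg_of_ae_exists_birkhoffSum_pos (hU : MeasurePreserving U P P)
    (hm : Measurable h) (hi : Integrable h P) (hpos : ∀ᵐ ω ∂P, ∃ k, 0 < birkhoffSum U h k ω) :
    0 ≤ ∫ ω, h ω ∂P := by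
  set A : ℕ → Set Ω := fun n => {ω | 0 < maxBirkhoffSum U h (n + 1) ω} with hA
  have hAm : ∀ n, MeasurableSet (A n) := fun n =>
    measurableSet_lt measurable_const (measurable_maxBirkhoffSum hU.measurable hm (n + 1))
  have hmono : Monotone A :=
    monotone_nat_of_le_succ fun n ω hω => lt_of_lt_of_le hω (maxBirkhoffSum_le_succ _ _)
  have hlim := tendsto_setIntegral_of_monotone hAm hmono (f := h) (μ := P) hi.integrableOn
  have hall : ∀ᵐ ω ∂P, ω ∈ ⋃ n, A n := by
    filter_upwards [hpos] with ω ⟨k, hk⟩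
    exact Set.mem_iUnion.2 ⟨k, hk.trans_le
      ((birkhoffSum_le_maxBirkhoffSum k ω).trans (maxBirkhoffSum_le_succ k ω))⟩
  have heq : ∫ ω in ⋃ n, A n, h ω ∂P = ∫ ω, h ω ∂P := by
    rw [Measure.restrict_eq_self_of_ae_mem hall]
  rw [← heq]
  exact ge_of_tendsto' hlim fun n => setIntegral_maxBirkhoffSum_pos_nonneg hU hm hi n

end MaximalErgodic

/-! ### Sublinearity along rays. -/

section Rays

variable {d : ℕ} {Ω : Type*} [MeasurableSpace Ω] {T : UnitStep d → Ω → Ω} {P : Measure Ω}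
  [IsProbabilityMeasure P] {F : Ω → UnitStep d → ℝ}

/-- Ergodicity of `U` is replaced by `hinv`: the upper growth rate of the Birkhoff sums is invariant
under every T_e, so the event that it exceeds ε is trivial. Probability one would contradict the
mean zero condition by the maximal ergodic theorem. -/
theorem IsErgodicFamily.ae_eventually_birkhoffSum_le (hT : IsErgodicFamily T P) {U : Ω → Ω}
    (hU : MeasurePreserving U P P) {h : Ω → ℝ} (hm : Measurable h) (hi : Integrable h P)
    (h0 : ∫ ω, h ω ∂P = 0)
    (hinv : ∀ e, ∀ᵐ ω ∂P, Tendsto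
      (fun k : ℕ => (birkhoffSum U h k (T e ω) - birkhoffSum U h k ω) / k) atTop (𝓝 0)) :
    ∀ᵐ ω ∂P, ∀ ε > 0, ∀ᶠ k : ℕ in atTop, birkhoffSum U h k ω ≤ ε * k := by
  have hSm : ∀ k, Measurable (birkhoffSum U h k) := fun k => by
    refine Finset.measurable_sum _ fun j _ => hm.comp (hU.measurable.iterate j)
  have key : ∀ ε > 0, ∀ᵐ ω ∂P, ∀ j : ℕ, ∀ᶠ k : ℕ in atTop,
      birkhoffSum U h k ω ≤ (ε + 1 / ((j : ℝ) + 1)) * k := by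
    intro ε hε
    -- The margin 1/(j+1) absorbs the o(k) error: passing from ω to T_e ω only replaces j by j + 1.
    set A : Set Ω := {ω | ∃ j : ℕ, ∃ᶠ k : ℕ in atTop,
      (ε + 1 / ((j : ℝ) + 1)) * k < birkhoffSum U h k ω} with hA
    have hAm : MeasurableSet A := by
      have : A = ⋃ j : ℕ, ⋂ a : ℕ, ⋃ k ∈ Set.Ici a,
          {ω | (ε + 1 / ((j : ℝ) + 1)) * k < birkhoffSum U h k ω} := by
        ext ω
        simp [hA, frequently_atTop]
      rw [this]
      refine MeasurableSet.iUnion fun j => MeasurableSet.iInter fun a =>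
        MeasurableSet.biUnion (Set.to_countable _) fun k _ => ?_
      exact measurableSet_lt measurable_const (hSm k)
    have hAinv : ∀ e, ∀ᵐ ω ∂P, ω ∈ A → T e ω ∈ A := fun e => by
      filter_upwards [hinv e] with ω hω ⟨j, hj⟩
      refine ⟨j + 1, ?_⟩
      set δ : ℝ := 1 / ((j : ℝ) + 1) - 1 / (((j + 1 : ℕ) : ℝ) + 1) with hδ
      have hδ0 : 0 < δ := sub_pos.2 (by
        refine one_div_lt_one_div_of_lt (by positivity) ?_
        push_cast
        linarith)
      have hev := hω.eventually_const_le (neg_lt_zero.2 hδ0)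
      refine (hj.and_eventually (hev.and (eventually_gt_atTop 0))).mono ?_
      rintro k ⟨h1, h2, h3⟩
      have hk : (0 : ℝ) < k := by exact_mod_cast h3
      rw [le_div_iff₀ hk] at h2
      have : (ε + 1 / ((j : ℝ) + 1)) * k =
        (ε + 1 / (((j + 1 : ℕ) : ℝ) + 1)) * k + δ * k := by rw [hδ]; ring
      linarith
    rcases hT.measure_eq_zero_or_one hAm hAinv with hP | hP
    · filter_upwards [measure_eq_zero_iff_ae_notMem.1 hP] with ω hω j
      have : ¬ ∃ᶠ k : ℕ in atTop, (ε + 1 / ((j : ℝ) + 1)) * k < birkhoffSum U h k ω :=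
        fun hj => hω ⟨j, hj⟩
      simpa [Filter.not_frequently] using this
    -- Almost every orbit would have a positive Birkhoff sum of h - ε, forcing -ε ≥ 0.
    · exfalso
      have hpos : ∀ᵐ ω ∂P, ∃ k, 0 < birkhoffSum U (fun ω => h ω - ε) k ω := by
        have hmem : ∀ᵐ ω ∂P, ω ∈ A := (mem_ae_iff_prob_eq_one hAm).2 hP
        filter_upwards [hmem] with ω ⟨j, hj⟩
        obtain ⟨k, hk⟩ := hj.exists
        refine ⟨k, ?_⟩
        have h1 : birkhoffSum U (fun ω => h ω - ε) k ω = birkhoffSum U h k ω - k * ε := by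
          simp [birkhoffSum, Finset.sum_sub_distrib]
        have h2 : (0 : ℝ) ≤ 1 / ((j : ℝ) + 1) * k := by positivity
        rw [h1]
        linarith
      have h1 := integral_nonneg_of_ae_exists_birkhoffSum_pos hU (hm.sub_const ε)
        (hi.sub (integrable_const ε)) hpos
      rw [integral_sub hi (integrable_const ε), h0] at h1
      simp at h1
      linarith
  have hall : ∀ᵐ ω ∂P, ∀ n : ℕ, ∀ j : ℕ, ∀ᶠ k : ℕ in atTop,
      birkhoffSum U h k ω ≤ (1 / ((n : ℝ) + 1) + 1 / ((j : ℝ) + 1)) * k :=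
    ae_all_iff.2 fun n => key _ (by positivity)
  filter_upwards [hall] with ω hω ε hε
  obtain ⟨n, hn⟩ := exists_nat_one_div_lt (half_pos hε)
  filter_upwards [hω n n] with k hk
  refine hk.trans ?_
  gcongr
  linarith

theorem IsErgodicFamily.ae_tendsto_birkhoffSum_div (hT : IsErgodicFamily T P) {U : Ω → Ω}
    (hU : MeasurePreserving U P P) {h : Ω → ℝ} (hm : Measurable h) (hi : Integrable h P)
    (h0 : ∫ ω, h ω ∂P = 0)
    (hinv : ∀ e, ∀ᵐ ω ∂P, Tendsto
      (fun k : ℕ => (birkhoffSum U h k (T e ω) - birkhoffSum U h k ω) / k) atTop (𝓝 0)) :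
    ∀ᵐ ω ∂P, Tendsto (fun k : ℕ => birkhoffSum U h k ω / k) atTop (𝓝 0) := by
  have hneg := hT.ae_eventually_birkhoffSum_le hU hm.neg hi.neg
    (by simp only [Pi.neg_apply, integral_neg, h0, neg_zero]) (fun e => by
      filter_upwards [hinv e] with ω hω
      refine (neg_zero (G := ℝ) ▸ hω.neg).congr fun k => ?_
      rw [show (-h) = fun ω => -h ω from rfl, birkhoffSum_neg', birkhoffSum_neg']
      ring)
  filter_upwards [hT.ae_eventually_birkhoffSum_le hU hm hi h0 hinv, hneg] with ω h1 h2
  rw [Metric.tendsto_nhds]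
  intro ε hε
  filter_upwards [h1 _ (half_pos hε), h2 _ (half_pos hε), eventually_gt_atTop 0] with k h3 h4 h5
  have hk : (0 : ℝ) < k := by exact_mod_cast h5
  rw [show (-h) = fun ω => -h ω from rfl, birkhoffSum_neg'] at h4
  rw [Real.dist_eq, sub_zero, abs_div, abs_of_pos hk, div_lt_iff₀ hk, abs_lt]
  have : 0 < ε / 2 * k := by positivity
  constructor <;> linarith

theorem IsErgodicFamily.ae_tendsto_pathPotential_ray (hT : IsErgodicFamily T P)
    (hFm : ∀ e, Measurable fun ω => F ω e) (hFi : ∀ e, Integrable (fun ω => F ω e) P)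
    (h0 : ∀ e, ∫ ω, F ω e ∂P = 0)
    (hloop : ∀ᵐ ω ∂P, ∀ (x : Fin d → ℤ) (γ : LatticePath x x), γ.sum T F ω = 0)
    (hinc : ∀ᵐ ω ∂P, ∀ (v : Fin d → ℤ) (i : Fin d), Tendsto (fun k : ℕ =>
      (pathPotential T F ω (k • v + Pi.single i 1) - pathPotential T F ω (k • v)) / k)
      atTop (𝓝 0)) :
    ∀ᵐ ω ∂P, ∀ v : Fin d → ℤ,
      Tendsto (fun k : ℕ => pathPotential T F ω (k • v) / k) atTop (𝓝 0) := by
  refine ae_all_iff.2 fun v => ?_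
  obtain ⟨γ⟩ := LatticePath.nonempty 0 v
  have hsum : ∀ ω, (∀ (x : Fin d → ℤ) (γ : LatticePath x x), γ.sum T F ω = 0) →
      ∀ (a : Fin d → ℤ) (k : ℕ),
      birkhoffSum (shift T v) (fun ω => γ.sum T F ω) k (shift T a ω) =
        pathPotential T F ω (k • v + a) - pathPotential T F ω a := by
    intro ω hω a k
    have h1 : ∀ j : ℕ, γ.sum T F ((shift T v)^[j] (shift T a ω)) =
        pathPotential T F ω ((j + 1) • v + a) - pathPotential T F ω (j • v + a) := fun j => by
      rw [hT.iterate_shift, ← hT.shift_add, hT.sum_shift hω, add_zero, succ_nsmul]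
      congr 2
      abel
    rw [birkhoffSum, Finset.sum_congr rfl fun j _ => h1 j,
      Finset.sum_range_sub (fun j => pathPotential T F ω (j • v + a))]
    simp
  have hpos : ∀ i, ∀ᵐ ω ∂P, Tendsto (fun k : ℕ =>
      (birkhoffSum (shift T v) (fun ω => γ.sum T F ω) k (T (UnitStep.pos i) ω) -
        birkhoffSum (shift T v) (fun ω => γ.sum T F ω) k ω) / k) atTop (𝓝 0) := fun i => by
    filter_upwards [hloop, hinc] with ω hω h1
    have h2 : ∀ k : ℕ, birkhoffSum (shift T v) (fun ω => γ.sum T F ω) k ω =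
        pathPotential T F ω (k • v) := fun k => by
      have := hsum ω hω 0 k
      rwa [hT.shift_zero, add_zero, pathPotential_zero hω, sub_zero] at this
    have h3 : Tendsto (fun k : ℕ => pathPotential T F ω (UnitStep.pos i).1 / k) atTop (𝓝 0) :=
      tendsto_const_div_atTop_nhds_zero_nat _
    have h4 := (h1 v i).sub h3
    rw [sub_zero] at h4
    refine h4.congr fun k => ?_
    rw [h2, ← hT.shift_unitStep, hsum ω hω]
    simp only [UnitStep.pos]
    ring
  have hlim := hT.ae_tendsto_birkhoffSum_div (hT.measurePreserving_shift v)
    (γ.measurable_sum hT hFm) (γ.integrable_sum hT hFi) (γ.integral_sum hT hFi h0) (fun e => by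
      obtain ⟨i, rfl | rfl⟩ := e.eq_pos_or_neg
      · exact hpos i
      -- The statement for -e follows from the one for e at the point T_{-e} ω, with the sign
      -- reversed.
      · have := (hT.measurePreserving (UnitStep.pos i).neg).quasiMeasurePreserving.ae (hpos i)
        filter_upwards [this] with ω hω
        have h1 : T (UnitStep.pos i) (T (UnitStep.pos i).neg ω) = ω := by
          simpa [UnitStep.neg_neg] using hT.inverse (UnitStep.pos i).neg ω
        rw [h1] at hω
        refine (neg_zero (G := ℝ) ▸ hω.neg).congr fun k => ?_
        ring)
  filter_upwards [hloop, hlim] with ω hω h1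
  refine h1.congr fun k => ?_
  have := hsum ω hω 0 k
  rw [hT.shift_zero, add_zero, pathPotential_zero hω, sub_zero] at this
  rw [this]

end Rays

/-! ### From dyadic cubes to balls, and the assembly. -/

section Sublinear

variable {d : ℕ}

/-- Rounding the radius up to a power of two costs a factor 2. Since f(0) = 0, both suprema are
nonnegative, so the upper bound on |f| settles both limits. -/
theorem tendsto_iSup_div_of_eventually_abs_le {f : (Fin d → ℤ) → ℝ} (hf0 : f 0 = 0)
    (hf : ∀ ε > 0, ∀ᶠ n : ℕ in atTop, ∀ z ∈ latticeBox (0 : Fin d → ℤ) (2 ^ n),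
      |f z| ≤ ε * 2 ^ n) :
    Tendsto (fun n : ℕ => ⨆ z : {z : Fin d → ℤ // l1norm z ≤ n}, f z.1 / (n : ℝ)) atTop (𝓝 0) ∧
    Tendsto (fun n : ℕ => ⨆ z : {z : Fin d → ℤ // l1norm z ≤ n}, |f z.1| / (n : ℝ))
      atTop (𝓝 0) := by
  have habs : ∀ ε > 0, ∀ᶠ n : ℕ in atTop, ∀ z : {z : Fin d → ℤ // l1norm z ≤ n},
      |f z.1| / (n : ℝ) ≤ ε := by
    intro ε hε
    obtain ⟨N, hN⟩ := eventually_atTop.1 (hf (ε / 2) (half_pos hε))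
    filter_upwards [eventually_ge_atTop (2 ^ N), eventually_gt_atTop 1] with n hn hn1
    rintro ⟨z, hz⟩
    have hn0 : (0 : ℝ) < n := by positivity
    set m := Nat.clog 2 n with hm
    have h1 : n ≤ 2 ^ m := Nat.le_pow_clog (by norm_num) _
    have hmN : N ≤ m := (Nat.pow_le_pow_iff_right (by norm_num)).1 (hn.trans h1)
    have hm0 : 0 < m := Nat.clog_pos (by norm_num) hn1
    have h2 : 2 ^ m ≤ 2 * n := by
      have h3 : 2 ^ m.pred < n := Nat.pow_pred_clog_lt_self (by norm_num) hn1
      have h4 : 2 ^ m = 2 * 2 ^ m.pred := by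
        rw [← pow_succ', Nat.pred_eq_sub_one, Nat.sub_add_cancel hm0]
      omega
    have hmem : z ∈ latticeBox (0 : Fin d → ℤ) (2 ^ m) := by
      rw [mem_latticeBox]
      intro i
      have h3 : (z i).natAbs ≤ l1norm z :=
        Finset.single_le_sum (f := fun i => (z i).natAbs) (fun _ _ => Nat.zero_le _)
          (Finset.mem_univ i)
      rw [Pi.zero_apply, sub_zero, Int.abs_eq_natAbs]
      exact_mod_cast h3.trans (hz.trans h1)
    have h3 := hN m hmN z hmem
    have h4 : (2 : ℝ) ^ m ≤ 2 * n := by exact_mod_cast h2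
    rw [div_le_iff₀ hn0]
    calc |f z| ≤ ε / 2 * 2 ^ m := h3
      _ ≤ ε / 2 * (2 * n) := by gcongr
      _ = ε * n := by ring
  have hzero : ∀ n : ℕ, l1norm (0 : Fin d → ℤ) ≤ n := fun n => by simp [l1norm]
  have key : ∀ φ : ℝ → ℝ, (φ 0 = 0) → (∀ x, φ x ≤ |x|) →
      Tendsto (fun n : ℕ => ⨆ z : {z : Fin d → ℤ // l1norm z ≤ n}, φ (f z.1) / (n : ℝ))
        atTop (𝓝 0) := by
    intro φ hφ0 hφ
    rw [Metric.tendsto_nhds]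
    intro ε hε
    filter_upwards [habs _ (half_pos hε)] with n hn
    have hle : ∀ z : {z : Fin d → ℤ // l1norm z ≤ n}, φ (f z.1) / (n : ℝ) ≤ ε / 2 := fun z =>
      (div_le_div_of_nonneg_right (hφ _) (Nat.cast_nonneg n)).trans (hn z)
    have : Nonempty {z : Fin d → ℤ // l1norm z ≤ n} := ⟨⟨0, hzero n⟩⟩
    have h1 : ⨆ z : {z : Fin d → ℤ // l1norm z ≤ n}, φ (f z.1) / (n : ℝ) ≤ ε / 2 := ciSup_le hle
    have h2 : 0 ≤ ⨆ z : {z : Fin d → ℤ // l1norm z ≤ n}, φ (f z.1) / (n : ℝ) := by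
      have := le_ciSup (f := fun z : {z : Fin d → ℤ // l1norm z ≤ n} => φ (f z.1) / (n : ℝ))
        ⟨ε / 2, by rintro _ ⟨z, rfl⟩; exact hle z⟩ ⟨0, hzero n⟩
      simpa [hf0, hφ0] using this
    rw [Real.dist_eq, sub_zero, abs_of_nonneg h2]
    linarith
  exact ⟨key id rfl le_abs_self, key (fun x => |x|) abs_zero fun _ => le_rfl⟩

variable {Ω : Type*} {T : UnitStep d → Ω → Ω} {F F' : Ω → UnitStep d → ℝ}

theorem LatticePath.sum_congr {ω : Ω}
    (h : ∀ x e, F (shift T x ω) e = F' (shift T x ω) e) {x y : Fin d → ℤ} (γ : LatticePath x y) :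
    γ.sum T F ω = γ.sum T F' ω := by
  induction γ with
  | nil _ => rfl
  | cons e γ ih => simp only [LatticePath.sum, ih, h]

variable [MeasurableSpace Ω] {P : Measure Ω}

/-- There are finitely many steps, so a single excess over d serves them all. In dimension zero
there are no steps, and p = 1 is taken to keep p ≥ 1. -/
theorem ClassK.exists_memLp_lt [IsFiniteMeasure P] (hF : ClassK T P F) :
    ∃ p : ℝ, 1 ≤ p ∧ d < p ∧ ∀ e, MemLp (fun ω => F ω e) (ENNReal.ofReal p) P := by
  rcases Nat.eq_zero_or_pos d with rfl | hd
  · exact ⟨1, le_rfl, by norm_num, fun e => by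
      obtain ⟨i, -⟩ := e.eq_pos_or_neg
      exact i.elim0⟩
  · choose α hα hL using hF.moment
    have hfin : Finite (UnitStep d) := by
      refine Finite.of_surjective
        (fun q : Fin d × Bool => if q.2 then UnitStep.pos q.1 else (UnitStep.pos q.1).neg) ?_
      intro e
      obtain ⟨i, rfl | rfl⟩ := e.eq_pos_or_neg
      · exact ⟨(i, true), rfl⟩
      · exact ⟨(i, false), rfl⟩
    have hev : ∀ᶠ a : ℝ in 𝓝[>] 0, ∀ e, a ≤ α e := eventually_all.2 fun e =>
      nhdsWithin_le_nhds (Iic_mem_nhds (hα e))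
    obtain ⟨a, ha, ha0⟩ := (hev.and self_mem_nhdsWithin).exists
    have ha0' : 0 < a := ha0
    have hd1 : (1 : ℝ) ≤ d := by exact_mod_cast hd
    refine ⟨d + a, by linarith, by linarith, fun e => (hL e).mono_exponent ?_⟩
    exact ENNReal.ofReal_le_ofReal (by linarith [ha e])

/-- The moment condition gives only almost everywhere measurability. Countably many
measure-preserving shifts allow measurable versions to be chosen that agree with F along almost
every orbit, leaving all path sums unchanged. -/
theorem ClassK.exists_measurable_congr (hT : IsErgodicFamily T P) [IsFiniteMeasure P]
    (hF : ClassK T P F) :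
    ∃ F' : Ω → UnitStep d → ℝ, (∀ e, Measurable fun ω => F' ω e) ∧ ClassK T P F' ∧
      ∀ᵐ ω ∂P, ∀ x e, F (shift T x ω) e = F' (shift T x ω) e := by
  have hm : ∀ e, AEStronglyMeasurable (fun ω => F ω e) P := fun e =>
    (hF.moment e).choose_spec.2.aestronglyMeasurable
  have hae : ∀ᵐ ω ∂P, ∀ x e, F (shift T x ω) e = (hm e).mk _ (shift T x ω) :=
    ae_all_iff.2 fun x => ae_all_iff.2 fun e =>
      (hT.measurePreserving_shift x).quasiMeasurePreserving.ae (hm e).ae_eq_mk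
  refine ⟨fun ω e => (hm e).mk _ ω, fun e => (hm e).stronglyMeasurable_mk.measurable,
    ⟨fun e => ?_, fun e => ?_, ?_⟩, hae⟩
  · obtain ⟨α, hα, hL⟩ := hF.moment e
    exact ⟨α, hα, hL.ae_eq (hm e).ae_eq_mk⟩
  · rw [← hF.mean_zero e]
    exact (integral_congr_ae (hm e).ae_eq_mk).symm
  · filter_upwards [hF.closed_loop, hae] with ω h1 h2 x γ
    rw [← LatticePath.sum_congr h2 γ]
    exact h1 x γ

/-- The energy over a cube is the sum over its points u of an integrable function evaluated at T_u
ω, so the maximal inequality applies. -/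
theorem IsErgodicFamily.ae_exists_gradientEnergy_le (hT : IsErgodicFamily T P)
    (hFm : ∀ e, Measurable fun ω => F ω e) {p : ℝ} (hp : 1 ≤ p)
    (hL : ∀ e, MemLp (fun ω => F ω e) (ENNReal.ofReal p) P)
    (hloop : ∀ᵐ ω ∂P, ∀ (x : Fin d → ℤ) (γ : LatticePath x x), γ.sum T F ω = 0) :
    ∀ᵐ ω ∂P, ∃ M : ℝ, 0 ≤ M ∧ ∀ k : ℕ,
      gradientEnergy (pathPotential T F ω) p (latticeBox 0 (2 ^ k)) ≤ M * 2 ^ (k * d) := by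
  have hp0 : 0 < p := by linarith
  set φ : Ω → ℝ := fun ω => ∑ i, |F ω (UnitStep.pos i)| ^ p with hφ
  have hφ0 : ∀ ω, 0 ≤ φ ω := fun ω => Finset.sum_nonneg fun _ _ => by positivity
  have hφm : Measurable φ :=
    Finset.measurable_sum _ fun i _ => ((hFm _).norm).pow_const p
  have hφi : Integrable φ P := by
    refine integrable_finsetSum _ fun i _ => ?_
    have := (hL (UnitStep.pos i)).integrable_norm_rpow (by simpa using hp0) (by simp)
    simpa [ENNReal.toReal_ofReal hp0.le] using this
  filter_upwards [hloop, hT.ae_exists_sum_latticeBox_le hφm.ennreal_ofReal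
    hφi.lintegral_lt_top.ne] with ω hω ⟨M, hM⟩
  refine ⟨M, Nat.cast_nonneg M, fun k => ?_⟩
  have h1 := hM k
  rw [← ENNReal.ofReal_sum_of_nonneg fun _ _ => hφ0 _] at h1
  have h2 : (M : ENNReal) * 2 ^ (k * d) = ENNReal.ofReal ((M : ℝ) * 2 ^ (k * d)) := by
    rw [ENNReal.ofReal_mul (Nat.cast_nonneg M), ENNReal.ofReal_natCast,
      ENNReal.ofReal_pow (by norm_num), ENNReal.ofReal_ofNat]
  rw [h2, ENNReal.ofReal_le_ofReal_iff (by positivity)] at h1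
  refine le_trans (le_of_eq ?_) h1
  refine Finset.sum_congr rfl fun u _ => Finset.sum_congr rfl fun i _ => ?_
  have := pathPotential_add_step hω u (UnitStep.pos i)
  simp only [UnitStep.pos] at this ⊢
  rw [this, add_sub_cancel_left]

theorem IsErgodicFamily.ae_eventually_abs_pathPotential_le [IsProbabilityMeasure P]
    (hT : IsErgodicFamily T P) (hFm : ∀ e, Measurable fun ω => F ω e) (hF : ClassK T P F) :
    ∀ᵐ ω ∂P, ∀ ε > 0, ∀ᶠ n : ℕ in atTop, ∀ z ∈ latticeBox (0 : Fin d → ℤ) (2 ^ n),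
      |pathPotential T F ω z| ≤ ε * 2 ^ n := by
  obtain ⟨p, hp, hdp, hL⟩ := hF.exists_memLp_lt
  have hFi : ∀ e, Integrable (fun ω => F ω e) P := fun e =>
    (hL e).integrable (by simpa using hp)
  have henergy := hT.ae_exists_gradientEnergy_le hFm hp hL hF.closed_loop
  have hray := hT.ae_tendsto_pathPotential_ray hFm hFi hF.mean_zero hF.closed_loop (by
    filter_upwards [henergy] with ω ⟨M, hM0, hM⟩ v i
    exact tendsto_increment_div_of_gradientEnergy_le hp hdp _ hM0 hM v i)
  filter_upwards [henergy, hray] with ω ⟨M, hM0, hM⟩ h ε hε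
  exact eventually_abs_le_of_gradientEnergy_le hp hdp _ hM0 hM h hε

end Sublinear

theorem theorem3 {d : ℕ} {Ω : Type*} [MeasurableSpace Ω] (P : Measure Ω) [IsProbabilityMeasure P]
    (T : UnitStep d → Ω → Ω) (hT : IsErgodicFamily T P)
    (F : Ω → UnitStep d → ℝ) (hF : ClassK T P F) :
    ∀ᵐ ω ∂P,
      (∀ (x y : Fin d → ℤ) (γ : LatticePath x y), γ.sum T F ω = sumBetween T F ω x y) ∧
      Tendsto (fun n : ℕ => ⨆ z : {z : Fin d → ℤ // l1norm z ≤ n},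
        pathPotential T F ω z.1 / (n : ℝ)) atTop (𝓝 0) ∧
      Tendsto (fun n : ℕ => ⨆ z : {z : Fin d → ℤ // l1norm z ≤ n},
        |pathPotential T F ω z.1| / (n : ℝ)) atTop (𝓝 0) := by
  obtain ⟨F', hFm, hF', hae⟩ := hF.exists_measurable_congr hT
  filter_upwards [hF.closed_loop, hae, hT.ae_eventually_abs_pathPotential_le hFm hF']
    with ω hloop hcongr hω
  refine ⟨fun x y γ => LatticePath.sum_eq_of_closed_loop hloop _ _,
    tendsto_iSup_div_of_eventually_abs_le (pathPotential_zero hloop) fun ε hε => ?_⟩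
  have heq : ∀ z, pathPotential T F ω z = pathPotential T F' ω z := fun z =>
    LatticePath.sum_congr hcongr _
  simpa only [heq] using hω ε hε
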